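/- Let $\gamma>1$, $\mu>0$, $L>0$. A state is a triple $(u,p,\rho)$ of positive numbers (axial velocity, pressure, density); put $c^2=\gamma p/\rho$, $t=M^2=u^2/c^2$ ($M$ the Mach number) and $E=\frac12u^2+\frac{\gamma}{\gamma-1}\frac p\rho$. A *Fanno flow* on an interval is a classical solution, up to the end points, of $$u'=\frac{\mu t}{1-t}\,u,\qquad p'=\frac{\mu\gamma t}{t-1}\,p,\qquad \rho'=\frac{\mu t}{t-1}\,\rho .$$ Given an entry state $U_b^-(0)$, a *background solution* with shock position $r_b\in(0,L)$ consists of a supersonic ($t>1$) Fanno flow $U_b^-$ on $[0,r_b]$ issuing from $U_b^-(0)$ and a subsonic ($t<1$) Fanno flow $U_b^+$ on $[r_b,L]$ such that $\rho u^2+p$, $\rho u$ and $\rho uE$ agree on the two sides of $r_b$ and $p^+>p^-$ there (a normal shock). Coefficients. Let $$d_1(t)=-\tfrac{(1+2\gamma)t^2+t-2}{t-1},\qquad d_2(t)=\tfrac{\gamma(1+\gamma)t^4-2\gamma(1+\gamma)t^3-(\gamma-3)t^2-2(4+\gamma)t+8}{(t-1)^3},$$ $$d_3(t)=\tfrac{\gamma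 t^2+3t-4}{(t-1)^3},\qquad d_4(t)=-\tfrac{\gamma(\gamma-1)t^3+(5\gamma-3)t^2-2(\gamma-4)t-8}{(\gamma-1)(t-1)^3}.$$ For a normal shock with states $U^-$ (front) and $U^+$ (back; quantities without superscript refer to it) let $$\mu_0=\frac{\rho u}{p^+-p^-},\qquad \mu_2=-2\mu\rho\Big\{\frac{(\gamma-1)u^2+c^2}{\gamma+1}+\frac{u^2}{c^2-u^2}\big((c^2)^--c^2\big)\Big\},$$ $$\mu_4=2\mu\rho^{1-\gamma}\Big\{\frac{\gamma-1}{\gamma+1}(c^2-u^2)+(c^2)^--c^2\Big\},\qquad \gamma_2=\frac{\rho u}{t-1},$$ $$\gamma_1=-\mu\frac{\gamma t^2-t+2}{(1-t)^2}-\mu\frac{t+\frac2{\gamma-1}}{(1-t)^2}\rho^\gamma\frac{\mu_4}{\mu_2},$$ $$\mu_5=-\frac1{\gamma_2},\quad \mu_6=-\frac{\gamma_1}{\gamma_2}\mu_2,\quad \mu_7=-\mu_0\mu_6,\quad \mu_8=-\mu_0\mu_2\mu_5 .$$ For a background solution take these constants at the shock at $r_b$, and on $[r_b,L]$, with $t,\rho$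 those of $U_b^+$, put $b(y)=e^{2\mu y}/\rho(y)$, $e_1=t-1$, $e_2=\mu d_1(t)$, $e_3=\mu^2d_2(t)$, $e_4=2\mu^3e^{-2\mu y}\rho\, d_3(t)$, $$e_5(y)=\mu^2\frac{\mu_4}{\mu_2}\Big(\rho^\gamma d_4(t)+\rho\, d_3(t)\int_{r_b}^{y}\frac{2\mu}{\gamma-1}e^{2\mu(\tau-y)}\rho(\tau)^{\gamma-1}\,d\tau\Big),$$ $$\tilde e_1=\frac{e_1}b,\qquad \tilde e_2=\frac{e_2}b-\frac{2e_1b'}{b^2},\qquad \tilde e_3=\frac{e_3+|m|^2}{b}-\frac{e_2b'+e_1b''}{b^2}+\frac{2e_1(b')^2}{b^3}.$$ The background solution satisfies the *S-Condition* if $\mu_2\neq0$ (so that all coefficients are defined) and for every $m\in\mathbb Z^2$ there is no $W\in C^3([r_b,L])$ with $$\tilde e_1W'''+\tilde e_2W''+\tilde e_3W'+e_4W+e_5=0\ \text{ on }[r_b,L],\qquad W(r_b)=0,\quad W'(r_b)=b(r_b),$$ $$W''(r_b)=b'(r_b)-\frac{\mu_7-|m|^2}{\mu_8}\,b(r_b),\qquad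 W'(L)=0 .$$ **Statement.** Let $t_0=\dfrac{\sqrt{9+16\gamma}-3}{2\gamma}$, the positive zero of $\gamma t^2+3t-4$. Suppose that the supersonic Fanno flow $U_b^-$ issuing from $U_b^-(0)$ exists and is supersonic on all of $[0,L]$, and that $\mu_2\ne0$ for a normal shock with front state $U_b^-(L)$ (this is automatic if $\gamma\le2$). Then there is an at most countable set $\mathcal S\subset(0,L)$ such that every background solution with entry state $U_b^-(0)$, shock position $r_b\in(0,L)\setminus\mathcal S$ and $t(y)<t_0$ for all $y\in(r_b,L)$ satisfies the S-Condition. -/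

import Mathlib

open Set MeasureTheory

noncomputable section

namespace Fanno

/-- State of an axial flow of a polytropic gas: axial velocity, pressure and density. -/
structure FlowState where
  u : ℝ
  p : ℝ
  ρ : ℝ

namespace FlowState

/-- Gas moving in the positive axial direction, with positive pressure and density. -/
structure Physical (s : FlowState) : Prop where
  u_pos : 0 < s.u
  p_pos : 0 < s.p
  ρ_pos : 0 < s.ρ

/-- Square of the sonic speed, `c² = γ p / ρ`. -/
def soundSq (γ : ℝ) (s : FlowState) : ℝ := γ * s.p / s.ρ

/-- Square of the Mach number, `t = M² = u² / c²`. -/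
def machSq (γ : ℝ) (s : FlowState) : ℝ := s.u ^ 2 / s.soundSq γ

/-- The Bernoulli constant `E = u²/2 + γ/(γ-1) · p/ρ`. -/
def bernoulli (γ : ℝ) (s : FlowState) : ℝ := s.u ^ 2 / 2 + γ / (γ - 1) * (s.p / s.ρ)

end FlowState

open FlowState

/-- One-dimensional steady flow with friction coefficient `μ` (Fanno flow) on `[a, b]`,
as a classical solution up to the end points. -/
structure IsFannoFlow (γ μ a b : ℝ) (V : ℝ → FlowState) : Prop where
  physical : ∀ x ∈ Icc a b, (V x).Physical
  hasDeriv_u : ∀ x ∈ Icc a b, HasDerivWithinAt (fun y => (V y).u)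
    (μ * (V x).machSq γ / (1 - (V x).machSq γ) * (V x).u) (Icc a b) x
  hasDeriv_p : ∀ x ∈ Icc a b, HasDerivWithinAt (fun y => (V y).p)
    (μ * γ * (V x).machSq γ / ((V x).machSq γ - 1) * (V x).p) (Icc a b) x
  hasDeriv_ρ : ∀ x ∈ Icc a b, HasDerivWithinAt (fun y => (V y).ρ)
    (μ * (V x).machSq γ / ((V x).machSq γ - 1) * (V x).ρ) (Icc a b) x

/-- The state `Sp` lies behind a normal shock whose front state is `Sm`: the Rankine-Hugoniot
conditions for momentum, mass and energy, and the physical entropy condition. -/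
structure IsNormalShock (γ : ℝ) (Sm Sp : FlowState) : Prop where
  physical_minus : Sm.Physical
  physical_plus : Sp.Physical
  momentum : Sp.ρ * Sp.u ^ 2 + Sp.p = Sm.ρ * Sm.u ^ 2 + Sm.p
  mass : Sp.ρ * Sp.u = Sm.ρ * Sm.u
  energy : Sp.ρ * Sp.u * Sp.bernoulli γ = Sm.ρ * Sm.u * Sm.bernoulli γ
  entropy : Sm.p < Sp.p

/-- A background solution `(Um, Up; rb)` in the duct of length `L` with entry state `U₀`:
supersonic Fanno flow on `[0, rb]`, a normal shock at `rb`, subsonic Fanno flow on `[rb, L]`. -/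
structure IsBackgroundSolution (γ μ L : ℝ) (U₀ : FlowState) (rb : ℝ)
    (Um Up : ℝ → FlowState) : Prop where
  position : rb ∈ Ioo 0 L
  entry : Um 0 = U₀
  flow_minus : IsFannoFlow γ μ 0 rb Um
  supersonic : ∀ x ∈ Icc 0 rb, 1 < (Um x).machSq γ
  flow_plus : IsFannoFlow γ μ rb L Up
  subsonic : ∀ x ∈ Icc rb L, (Up x).machSq γ < 1
  shock : IsNormalShock γ (Um rb) (Up rb)

/-! Coefficients of the linearised equation for the pressure, as functions of `t = M²`. -/

def d₁ (γ t : ℝ) : ℝ := -(1 / (t - 1)) * ((1 + 2 * γ) * t ^ 2 + t - 2)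

def d₂ (γ t : ℝ) : ℝ :=
  1 / (t - 1) ^ 3 * (γ * (1 + γ) * t ^ 4 - 2 * γ * (1 + γ) * t ^ 3 - (γ - 3) * t ^ 2
    - 2 * (4 + γ) * t + 8)

def d₃ (γ t : ℝ) : ℝ := 1 / (t - 1) ^ 3 * (γ * t ^ 2 + 3 * t - 4)

def d₄ (γ t : ℝ) : ℝ :=
  -(1 / (γ - 1)) * (1 / (t - 1) ^ 3) *
    (γ * (γ - 1) * t ^ 3 + (5 * γ - 3) * t ^ 2 - 2 * (γ - 4) * t - 8)

/-- The threshold `t₀(γ)`: the only positive zero of `γ t² + 3 t - 4`, that is, of `d₃ γ`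
on `(0, 1)`. -/
def t₀ (γ : ℝ) : ℝ := (Real.sqrt (9 + 16 * γ) - 3) / (2 * γ)

/-! Constants obtained by linearising the Rankine-Hugoniot conditions at a shock with front
state `Sm` and back state `Sp`. -/

def μ₀ (Sm Sp : FlowState) : ℝ := Sp.ρ * Sp.u / (Sp.p - Sm.p)

def μ₂ (γ μ : ℝ) (Sm Sp : FlowState) : ℝ :=
  -2 * μ * Sp.ρ * (1 / (γ + 1) * ((γ - 1) * Sp.u ^ 2 + Sp.soundSq γ)
    + Sp.u ^ 2 / (Sp.soundSq γ - Sp.u ^ 2) * (Sm.soundSq γ - Sp.soundSq γ))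

def μ₄ (γ μ : ℝ) (Sm Sp : FlowState) : ℝ :=
  2 * μ * Sp.ρ ^ (1 - γ) * ((γ - 1) / (γ + 1) * (Sp.soundSq γ - Sp.u ^ 2)
    + (Sm.soundSq γ - Sp.soundSq γ))

/-- Coefficient of the pressure perturbation in the linearised boundary condition, before the
entropy perturbation is eliminated. -/
def γ₀ (γ μ t : ℝ) : ℝ := -μ * ((γ * t ^ 2 - t + 2) / (1 - t) ^ 2)

/-- Coefficient of `p̂` in `∂₀p̂ + γ₁ p̂ + γ₂ div' u' + … = 0` on the shock front: to `γ₀` is added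
the contribution of the entropy perturbation `(μ₄/μ₂) p̂`. -/
def γ₁ (γ μ : ℝ) (Sm Sp : FlowState) : ℝ :=
  γ₀ γ μ (Sp.machSq γ)
    - μ * ((Sp.machSq γ + 2 / (γ - 1)) / (1 - Sp.machSq γ) ^ 2) * Sp.ρ ^ γ
      * (μ₄ γ μ Sm Sp / μ₂ γ μ Sm Sp)

/-- Coefficient of `div' u'` in the same condition. -/
def γ₂ (γ : ℝ) (Sp : FlowState) : ℝ := Sp.ρ * Sp.u / (Sp.machSq γ - 1)

def μ₅ (γ : ℝ) (Sp : FlowState) : ℝ := -(1 / γ₂ γ Sp)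

def μ₆ (γ μ : ℝ) (Sm Sp : FlowState) : ℝ := -(γ₁ γ μ Sm Sp / γ₂ γ Sp) * μ₂ γ μ Sm Sp

def μ₇ (γ μ : ℝ) (Sm Sp : FlowState) : ℝ := -(μ₀ Sm Sp * μ₆ γ μ Sm Sp)

def μ₈ (γ μ : ℝ) (Sm Sp : FlowState) : ℝ := -(μ₀ Sm Sp * μ₂ γ μ Sm Sp * μ₅ γ Sp)

/-! Coefficients of the nonlocal equation on `[rb, L]`; `V` is the subsonic flow there. -/

def e₁ (γ : ℝ) (V : ℝ → FlowState) (y : ℝ) : ℝ := (V y).machSq γ - 1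

def e₂ (γ μ : ℝ) (V : ℝ → FlowState) (y : ℝ) : ℝ := μ * d₁ γ ((V y).machSq γ)

def e₃ (γ μ : ℝ) (V : ℝ → FlowState) (y : ℝ) : ℝ := μ ^ 2 * d₂ γ ((V y).machSq γ)

def e₄ (γ μ : ℝ) (V : ℝ → FlowState) (y : ℝ) : ℝ :=
  2 * μ ^ 3 * Real.exp (-2 * μ * y) * (V y).ρ * d₃ γ ((V y).machSq γ)

def e₅ (γ μ rb : ℝ) (Sm : FlowState) (V : ℝ → FlowState) (y : ℝ) : ℝ :=
  μ ^ 2 * (μ₄ γ μ Sm (V rb) / μ₂ γ μ Sm (V rb)) *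
    ((V y).ρ ^ γ * d₄ γ ((V y).machSq γ)
      + (V y).ρ * d₃ γ ((V y).machSq γ) *
        ∫ τ in rb..y, 2 * μ / (γ - 1) * Real.exp (2 * μ * (τ - y)) * (V τ).ρ ^ (γ - 1))

def b (μ : ℝ) (V : ℝ → FlowState) (y : ℝ) : ℝ := Real.exp (2 * μ * y) / (V y).ρ

/-- `∂b/∂y` on `[rb, L]`. -/
def b' (μ rb L : ℝ) (V : ℝ → FlowState) : ℝ → ℝ := derivWithin (b μ V) (Icc rb L)

/-- `∂²b/∂y²` on `[rb, L]`. -/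
def b'' (μ rb L : ℝ) (V : ℝ → FlowState) : ℝ → ℝ := derivWithin (b' μ rb L V) (Icc rb L)

def eTilde₁ (γ μ : ℝ) (V : ℝ → FlowState) (y : ℝ) : ℝ := e₁ γ V y / b μ V y

def eTilde₂ (γ μ rb L : ℝ) (V : ℝ → FlowState) (y : ℝ) : ℝ :=
  e₂ γ μ V y / b μ V y - 2 * e₁ γ V y * b' μ rb L V y / b μ V y ^ 2

/-- Here `k` stands for `|m|²`. -/
def eTilde₃ (γ μ rb L k : ℝ) (V : ℝ → FlowState) (y : ℝ) : ℝ :=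
  (e₃ γ μ V y + k) / b μ V y
    - (e₂ γ μ V y * b' μ rb L V y + e₁ γ V y * b'' μ rb L V y) / b μ V y ^ 2
    + 2 * e₁ γ V y * b' μ rb L V y ^ 2 / b μ V y ^ 3

/-- `W` is a classical (that is, `C³` on `[rb, L]`) solution of the third order boundary value
problem with the three initial conditions at `rb` and the condition `W'(L) = 0`; here `k = |m|²`,
and `W₁`, `W₂`, `W₃` are the derivatives of `W`. -/
structure IsClassicalSolution (γ μ L rb k : ℝ) (Um Up : ℝ → FlowState)
    (W W₁ W₂ W₃ : ℝ → ℝ) : Prop where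
  deriv₁ : ∀ y ∈ Icc rb L, HasDerivWithinAt W (W₁ y) (Icc rb L) y
  deriv₂ : ∀ y ∈ Icc rb L, HasDerivWithinAt W₁ (W₂ y) (Icc rb L) y
  deriv₃ : ∀ y ∈ Icc rb L, HasDerivWithinAt W₂ (W₃ y) (Icc rb L) y
  continuous₃ : ContinuousOn W₃ (Icc rb L)
  equation : ∀ y ∈ Icc rb L,
    eTilde₁ γ μ Up y * W₃ y + eTilde₂ γ μ rb L Up y * W₂ y + eTilde₃ γ μ rb L k Up y * W₁ y
      + e₄ γ μ Up y * W y + e₅ γ μ rb (Um rb) Up y = 0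
  initial₀ : W rb = 0
  initial₁ : W₁ rb = b μ Up rb
  initial₂ : W₂ rb = b' μ rb L Up rb
    - (μ₇ γ μ (Um rb) (Up rb) - k) / μ₈ γ μ (Um rb) (Up rb) * b μ Up rb
  exit : W₁ L = 0

/-- The S-Condition: the coefficients of the boundary value problems make sense (their only
denominator that could vanish is `μ₂`), and for every frequency `m ∈ ℤ²` the problem has no
classical solution. -/
def SCondition (γ μ L rb : ℝ) (Um Up : ℝ → FlowState) : Prop :=
  μ₂ γ μ (Um rb) (Up rb) ≠ 0 ∧
    ∀ m : ℤ × ℤ, ¬ ∃ W W₁ W₂ W₃ : ℝ → ℝ,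
      IsClassicalSolution γ μ L rb ((m.1 : ℝ) ^ 2 + (m.2 : ℝ) ^ 2) Um Up W W₁ W₂ W₃

end Fanno

end

/-! The shock position matters only through the squared Mach number `τ` in front of the shock. Along
a Fanno flow `machPotential t = 1/t + log t` is affine in the axial variable, with slope `-μ(γ+1)`
on both branches. Hence the potential at the subsonic exit is `potentialJump γ τ + e`, with `e` the
exit potential of the shock-free flow, and the exit Mach number is an analytic function of `τ`.

With the pressure amplitude `P = W'/b`, the third order equation becomes a linear first order system
for `P`, `P'`, a combination of `W` with the entropy integral, and an entropy term. Its coefficients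
depend on position only through `t`. With `t` as independent variable it is holomorphic on the disc
with diameter `(0, 1)`, so it has a holomorphic fundamental solution `Ψ` there, with inverse `Θ`.
The initial data, multiplied by `normμ₂`, are analytic in `τ`. The resulting exit value `exitAmp` is
analytic in `τ`, and a solution of the boundary value problem forces it to vanish.

The domain `K` of `exitAmp` consists of those `τ > 1` whose exit potential exceeds 1. It is an
interval because `potentialJump` is quasiconcave. It contains `τ L`, the case of a shock at the
exit: the subsonic stretch then has length zero and `exitAmp = normμ₂ ≠ 0`. So `exitAmp` has
countably many zeros for each `|m|²`. The union over `m`, together with the zeros of `normμ₂`, is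
pulled back by the injective map `x ↦ τ x`. -/

noncomputable section

namespace Fanno
open Filter Topology Metric

/-! ### Linear equations with holomorphic coefficients on a disc. -/

section LinearODE

variable {R : Type*} [NormedRing R] [NormedAlgebra ℂ R]

/-- Taylor coefficients of the solution of `Y' = A Y`, `Y(c) = 1`, where `a` are the Taylor
coefficients of `A`. -/
def odeCoeff (a : ℕ → R) : ℕ → R
  | 0 => 1
  | n + 1 => ((n + 1 : ℕ) : ℂ)⁻¹ • ∑ i : Fin (n + 1), a (n - i) * odeCoeff a i

theorem odeCoeff_succ (a : ℕ → R) (n : ℕ) :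
    ((n + 1 : ℕ) : ℂ) • odeCoeff a (n + 1)
      = ∑ i ∈ Finset.range (n + 1), a (n - i) * odeCoeff a i := by
  rw [odeCoeff, smul_smul, mul_inv_cancel₀ (by exact_mod_cast Nat.succ_ne_zero n), one_smul,
    Finset.sum_range]

/-- If the coefficients of `A` are bounded by `C ρ⁻ⁿ`, the solution series converges absolutely,
together with its derivative, on every smaller disc. -/
theorem summable_odeCoeff (a : ℕ → R) {C ρ σ : ℝ} (hσ : 0 < σ) (hσρ : σ < ρ)
    (ha : ∀ n, ‖a n‖ * ρ ^ n ≤ C) :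
    Summable fun n : ℕ => (n : ℝ) * ‖odeCoeff a n‖ * σ ^ n := by
  have hρ : 0 < ρ := hσ.trans hσρ
  have hC : 0 ≤ C := le_trans (by positivity) (ha 0)
  set y := odeCoeff a
  -- Partial sums turn the convolution recursion into a one-step inequality with growth factor `1 +
  -- Cρ/(n+1) → 1`, so `S n` grows more slowly than any exponential.
  let S : ℕ → ℝ := fun n => ∑ i ∈ Finset.range (n + 1), ‖y i‖ * ρ ^ i
  have hS0 : ∀ n, 0 ≤ S n := fun n => Finset.sum_nonneg fun i _ => by positivity
  have hstep : ∀ n : ℕ, ((n : ℝ) + 1) * S (n + 1) ≤ (n + 1 + C * ρ) * S n := by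
    intro n
    have h1 : ((n : ℝ) + 1) * (‖y (n + 1)‖ * ρ ^ (n + 1)) ≤ C * ρ * S n := by
      have h2 : ((n : ℝ) + 1) * ‖y (n + 1)‖ = ‖((n + 1 : ℕ) : ℂ) • y (n + 1)‖ := by
        rw [norm_smul, Complex.norm_natCast]; push_cast; ring
      rw [← mul_assoc, h2, odeCoeff_succ]
      calc ‖∑ i ∈ Finset.range (n + 1), a (n - i) * y i‖ * ρ ^ (n + 1)
          ≤ (∑ i ∈ Finset.range (n + 1), ‖a (n - i)‖ * ‖y i‖) * ρ ^ (n + 1) := by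
            gcongr
            exact (norm_sum_le _ _).trans (Finset.sum_le_sum fun i _ => norm_mul_le _ _)
        _ = ∑ i ∈ Finset.range (n + 1), ρ * ((‖a (n - i)‖ * ρ ^ (n - i)) * (‖y i‖ * ρ ^ i)) := by
            rw [Finset.sum_mul]
            refine Finset.sum_congr rfl fun i hi => ?_
            have : n + 1 = (n - i) + i + 1 := by
              have := Finset.mem_range.1 hi; omega
            rw [this, pow_succ, pow_add]
            have h3 : n - i + i + 1 - 1 - i = n - i := by omega
            ring
        _ ≤ ∑ i ∈ Finset.range (n + 1), ρ * (C * (‖y i‖ * ρ ^ i)) := by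
            gcongr with i hi; exact ha _
        _ = C * ρ * S n := by
            simp only [S, Finset.mul_sum]
            refine Finset.sum_congr rfl fun i _ => by ring
    have h4 : S (n + 1) = S n + ‖y (n + 1)‖ * ρ ^ (n + 1) := Finset.sum_range_succ _ _
    rw [h4]; linarith
  set x := σ / ρ
  have hx0 : 0 < x := by positivity
  have hx1 : x < 1 := (div_lt_one hρ).2 hσρ
  obtain ⟨r, hxr, hr1⟩ := exists_between hx1
  have hsum : Summable fun n : ℕ => (n : ℝ) * S n * x ^ n := by
    refine summable_of_ratio_norm_eventually_le hr1 ?_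
    -- Beyond this `N` one has `(n + 1 + Cρ) x ≤ r n`, which is the ratio test with ratio `r`.
    obtain ⟨N, hN⟩ := exists_nat_ge ((1 + C * ρ) * x / (r - x))
    filter_upwards [eventually_ge_atTop N] with n hn
    have hn' : (1 + C * ρ) * x ≤ (r - x) * n := by
      have : (1 + C * ρ) * x / (r - x) ≤ n := hN.trans (by exact_mod_cast hn)
      rwa [div_le_iff₀ (by linarith), mul_comm (n : ℝ)] at this
    have hnn : ∀ k : ℕ, 0 ≤ (k : ℝ) * S k * x ^ k := fun k =>
      mul_nonneg (mul_nonneg (Nat.cast_nonneg k) (hS0 k)) (by positivity)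
    rw [Real.norm_of_nonneg (hnn _), Real.norm_of_nonneg (hnn _)]
    push_cast
    calc ((n : ℝ) + 1) * S (n + 1) * x ^ (n + 1)
        ≤ (n + 1 + C * ρ) * S n * x ^ (n + 1) := by
          gcongr ?_ * _; exact hstep n
      _ = ((n + 1 + C * ρ) * x) * (S n * x ^ n) := by ring
      _ ≤ (r * n) * (S n * x ^ n) := by
          exact mul_le_mul_of_nonneg_right (by linarith) (mul_nonneg (hS0 n) (by positivity))
      _ = r * (n * S n * x ^ n) := by ring
  refine Summable.of_nonneg_of_le (fun n => by positivity) (fun n => ?_) hsum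
  have h5 : ‖y n‖ * ρ ^ n ≤ S n :=
    Finset.single_le_sum (f := fun i => ‖y i‖ * ρ ^ i) (fun i _ => by positivity)
      (Finset.self_mem_range_succ n)
  have h6 : σ = ρ * x := by simp only [x]; field_simp
  calc (n : ℝ) * ‖y n‖ * σ ^ n = n * (‖y n‖ * ρ ^ n) * x ^ n := by rw [h6, mul_pow]; ring
    _ ≤ n * S n * x ^ n := by gcongr

/-- A linear equation with holomorphic coefficient on a disc has a holomorphic fundamental
solution on the whole disc. -/
theorem exists_fundamental_solution [CompleteSpace R] {A : ℂ → R} {c : ℂ} {r : ℝ}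
    (hA : DifferentiableOn ℂ A (ball c r)) :
    ∃ Y : ℂ → R, Y c = 1 ∧ ∀ z ∈ ball c r, HasDerivAt Y (A z * Y z) z := by
  let a : ℕ → R := fun n => (n.factorial : ℂ)⁻¹ • iteratedDeriv n A c
  have hAsum : ∀ z ∈ ball c r, HasSum (fun n : ℕ => (z - c) ^ n • a n) (A z) := by
    intro z hz
    have := Complex.hasSum_taylorSeries_on_ball hA hz
    simpa only [a, smul_comm _ ((_ : ℂ)⁻¹)] using this
  let y := odeCoeff a
  refine ⟨fun z => ∑' n : ℕ, (z - c) ^ n • y n, ?_, fun z hz => ?_⟩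
  · simp only [sub_self]
    rw [tsum_eq_single 0 fun n hn => by simp [hn]]
    simp [y, odeCoeff]
  obtain ⟨σ, hzσ, hσr⟩ := exists_between (mem_ball.1 hz)
  obtain ⟨ρ', hσρ', hρ'r⟩ := exists_between hσr
  have hσ0 : 0 < σ := dist_nonneg.trans_lt hzσ
  have hρ0 : 0 < ρ' := hσ0.trans hσρ'
  -- The Taylor series converges at the point `c + ρ'`, so its terms there are bounded.
  have hbound : ∃ C, ∀ n, ‖a n‖ * ρ' ^ n ≤ C := by
    have hmem : c + (ρ' : ℂ) ∈ ball c r := by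
      simp [mem_ball, dist_eq_norm, abs_of_pos hρ0, hρ'r]
    obtain ⟨C, hC⟩ := ((hAsum _ hmem).summable.tendsto_atTop_zero.norm).bddAbove_range
    refine ⟨C, fun n => ?_⟩
    have := hC (mem_range_self n)
    simpa [norm_smul, abs_of_pos hρ0, mul_comm] using this
  obtain ⟨C, hC⟩ := hbound
  have hsum := summable_odeCoeff a hσ0 hσρ' hC
  have hsum' : Summable fun n : ℕ => (n : ℝ) * ‖y n‖ * σ ^ (n - 1) := by
    refine (hsum.mul_right σ⁻¹).congr fun n => ?_
    rcases n with _ | n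
    · simp
    · simp only [Nat.add_sub_cancel, pow_succ]; field_simp; rfl
  have hder : HasDerivAt (fun z => ∑' n : ℕ, (z - c) ^ n • y n)
      (∑' n : ℕ, ((n : ℂ) * (z - c) ^ (n - 1)) • y n) z := by
    refine hasDerivAt_tsum_of_isPreconnected (t := ball c σ) (y₀ := c)
      (g' := fun (n : ℕ) z => ((n : ℂ) * (z - c) ^ (n - 1)) • y n) hsum' isOpen_ball
      (convex_ball c σ).isPreconnected (fun n w _ => ?_) (fun n w hw => ?_)
      (mem_ball_self hσ0) ?_ hzσ
    · have := (((hasDerivAt_id w).sub_const c).pow n).smul_const (y n)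
      simpa using this
    · rw [norm_smul, norm_mul, norm_pow, Complex.norm_natCast, mul_right_comm]
      have : ‖w - c‖ ≤ σ := by rw [← dist_eq_norm]; exact (mem_ball.1 hw).le
      gcongr
    · refine summable_of_ne_finset_zero (s := {0}) fun n hn => ?_
      simp at hn; simp [hn]
  convert hder using 1
  have hzc : ‖z - c‖ ≤ σ := by rw [← dist_eq_norm]; exact hzσ.le
  have hs1 : Summable fun n : ℕ => ‖(z - c) ^ n • a n‖ := by
    have hx1 : σ / ρ' < 1 := (div_lt_one hρ0).2 hσρ'
    refine Summable.of_nonneg_of_le (fun n => norm_nonneg _) (fun n => ?_)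
      ((summable_geometric_of_lt_one (by positivity) hx1).mul_left C)
    rw [norm_smul, norm_pow]
    calc ‖z - c‖ ^ n * ‖a n‖ ≤ σ ^ n * ‖a n‖ := by gcongr
      _ = (‖a n‖ * ρ' ^ n) * (σ / ρ') ^ n := by rw [div_pow]; field_simp
      _ ≤ _ := by gcongr; exact hC n
  have hs2 : Summable fun n : ℕ => ‖(z - c) ^ n • y n‖ := by
    rw [← summable_nat_add_iff 1]
    refine Summable.of_nonneg_of_le (fun n => norm_nonneg _) (fun n => ?_)
      ((summable_nat_add_iff 1).2 hsum)
    rw [norm_smul, norm_pow]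
    have h1 : (1 : ℝ) ≤ ((n + 1 : ℕ) : ℝ) := by push_cast; linarith [(n.cast_nonneg : (0 : ℝ) ≤ n)]
    calc ‖z - c‖ ^ (n + 1) * ‖y (n + 1)‖ ≤ σ ^ (n + 1) * ‖y (n + 1)‖ := by gcongr
      _ = 1 * ‖y (n + 1)‖ * σ ^ (n + 1) := by ring
      _ ≤ _ := by gcongr
  have hs3 : Summable fun n : ℕ => ((n : ℂ) * (z - c) ^ (n - 1)) • y n := by
    refine Summable.of_norm_bounded hsum' fun n => ?_
    rw [norm_smul, norm_mul, norm_pow, Complex.norm_natCast, mul_right_comm]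
    gcongr
  -- The product `A Y` is a Cauchy product; its coefficients match those of `Y'` by the recursion
  -- for `odeCoeff`.
  rw [← (hAsum z hz).tsum_eq, tsum_mul_tsum_eq_tsum_sum_antidiagonal_of_summable_norm hs1 hs2,
    hs3.tsum_eq_zero_add]
  simp only [Nat.cast_zero, zero_mul, zero_smul, zero_add, Nat.add_sub_cancel]
  refine tsum_congr fun n => ?_
  rw [mul_comm, mul_smul, odeCoeff_succ, Finset.smul_sum,
    ← Finset.Nat.sum_antidiagonal_eq_sum_range_succ
      (fun i j => (z - c) ^ n • (a j * odeCoeff a i)), ← Finset.Nat.sum_antidiagonal_swap]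
  refine Finset.sum_congr rfl fun p hp => ?_
  rw [← Finset.HasAntidiagonal.mem_antidiagonal.1 hp]
  simp only [Prod.fst_swap, Prod.snd_swap, smul_mul_smul_comm, ← pow_add]
  rw [add_comm]

/-- Together with a holomorphic fundamental solution comes its inverse, the fundamental solution
of the adjoint equation. -/
theorem exists_fundamental_pair [CompleteSpace R] {A : ℂ → R} {c : ℂ} {r : ℝ}
    (hA : DifferentiableOn ℂ A (ball c r)) :
    ∃ Y Z : ℂ → R, (∀ z ∈ ball c r, HasDerivAt Y (A z * Y z) z) ∧
      (∀ z ∈ ball c r, HasDerivAt Z (-(Z z * A z)) z) ∧ ∀ z ∈ ball c r, Z z * Y z = 1 := by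
  obtain ⟨Y, hY0, hY⟩ := exists_fundamental_solution hA
  -- In `Z' = -Z A` the coefficient acts from the right; in the opposite ring it acts from the left.
  have hA' : DifferentiableOn ℂ (fun z => MulOpposite.op (-A z)) (ball c r) :=
    ((MulOpposite.opContinuousLinearEquiv ℂ : R ≃L[ℂ] Rᵐᵒᵖ).differentiable.comp_differentiableOn
      hA.neg)
  obtain ⟨X, hX0, hX⟩ := exists_fundamental_solution hA'
  have hZ : ∀ z ∈ ball c r,
      HasDerivAt (fun z => (X z).unop) (-((X z).unop * A z)) z := by
    intro z hz
    have := ((MulOpposite.opContinuousLinearEquiv ℂ : R ≃L[ℂ] Rᵐᵒᵖ).symm.hasFDerivAt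
      (x := X z)).comp_hasDerivAt z (hX z hz)
    simpa [Function.comp_def] using this
  refine ⟨Y, fun z => (X z).unop, hY, hZ, fun z hz => ?_⟩
  have hd : ∀ w ∈ ball c r, HasDerivAt (fun z => (X z).unop * Y z) 0 w := by
    intro w hw
    have := (hZ w hw).mul (hY w hw)
    rwa [neg_mul, mul_assoc, neg_add_cancel] at this
  have hc : c ∈ ball c r := mem_ball_self (pos_of_mem_ball hz)
  have := (convex_ball c r).is_const_of_fderivWithin_eq_zero (𝕜 := ℂ)
    (fun w hw => (hd w hw).differentiableAt.differentiableWithinAt)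
    (fun w hw => ?_) hz hc
  · simpa [hX0, hY0] using this
  · rw [fderivWithin_of_isOpen isOpen_ball hw]
    exact (hd w hw).hasFDerivAt.fderiv.trans (by ext; simp)

end LinearODE

/-! ### Zeros of analytic functions. -/

/-- The zeros of an analytic function on an interval are countable unless it vanishes
identically. -/
theorem countable_zeros_of_preconnected {E : Type*} [NormedAddCommGroup E] [NormedSpace ℝ E]
    {K : Set ℝ} {f : ℝ → E} (hf : AnalyticOnNhd ℝ f K) (hK : IsPreconnected K) {x : ℝ}
    (hx : x ∈ K) (hfx : f x ≠ 0) : {y ∈ K | f y = 0}.Countable := by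
  have hmem : {y | f y = 0}ᶜ ∈ codiscreteWithin K := by
    rw [mem_codiscreteWithin_iff_forall_mem_nhdsNE]
    intro y hy
    rcases (hf y hy).eventually_eq_zero_or_eventually_ne_zero with h | h
    · exact absurd (hf.eqOn_zero_of_preconnected_of_frequently_eq_zero hK hy
        (h.filter_mono nhdsWithin_le_nhds).frequently hx) hfx
    · exact mem_of_superset h fun w hw => Or.inl hw
  have hd := isDiscrete_of_codiscreteWithin hmem
  exact ((HereditarilyLindelofSpace.isLindelof _).countable_of_isDiscrete hd).mono
    fun y hy => And.intro hy.2 hy.1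

/-! ### The Mach potential and its subsonic inverse. -/

/-- The function of the squared Mach number that varies linearly along a Fanno flow. -/
def machPotential (t : ℝ) : ℝ := t⁻¹ + Real.log t

/-- This factor cancels the one in `t' = μ(γ+1)t²/(1-t)`, which makes the potential linear along the
flow. -/
theorem hasDerivAt_machPotential {t : ℝ} (ht : 0 < t) :
    HasDerivAt machPotential ((t - 1) / t ^ 2) t := by
  have := (hasDerivAt_inv ht.ne').add (Real.hasDerivAt_log ht.ne')
  refine this.congr_deriv ?_
  field_simp
  ring

theorem analyticAt_machPotential {t : ℝ} (ht : 0 < t) : AnalyticAt ℝ machPotential t :=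
  (analyticAt_id.inv ht.ne').add (analyticAt_log ht)

theorem continuousOn_machPotential : ContinuousOn machPotential (Ioi 0) := fun _ ht =>
  (hasDerivAt_machPotential ht).continuousAt.continuousWithinAt

theorem machPotential_one : machPotential 1 = 1 := by simp [machPotential]

theorem strictMonoOn_machPotential : StrictMonoOn machPotential (Ici 1) := by
  refine strictMonoOn_of_deriv_pos (convex_Ici 1)
    (continuousOn_machPotential.mono fun t ht => mem_Ioi.2 (one_pos.trans_le ht)) fun t ht => ?_
  rw [interior_Ici, mem_Ioi] at ht
  rw [(hasDerivAt_machPotential (one_pos.trans ht)).deriv]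
  have := one_pos.trans ht
  have : 0 < t - 1 := by linarith
  positivity

theorem strictAntiOn_machPotential : StrictAntiOn machPotential (Ioc 0 1) := by
  refine strictAntiOn_of_deriv_neg (convex_Ioc 0 1)
    (continuousOn_machPotential.mono fun t ht => ht.1) fun t ht => ?_
  rw [interior_Ioc] at ht
  rw [(hasDerivAt_machPotential ht.1).deriv]
  exact div_neg_of_neg_of_pos (by linarith [ht.2]) (pow_pos ht.1 2)

theorem one_lt_machPotential {t : ℝ} (ht : t ∈ Ioo 0 1) : 1 < machPotential t := by
  have := strictAntiOn_machPotential ⟨ht.1, ht.2.le⟩ ⟨one_pos, le_rfl⟩ ht.2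
  rwa [machPotential_one] at this

theorem exists_machPotential_eq {y : ℝ} (hy : 1 < y) : ∃ t ∈ Ioo (0 : ℝ) 1, machPotential t = y := by
  have hy0 : 0 < y := one_pos.trans hy
  -- At `exp (-y)` the potential is `exp y - y ≥ 1 + y²/2 > y`; at 1 it is 1, below `y`.
  set a := Real.exp (-y)
  have ha0 : 0 < a := Real.exp_pos _
  have ha1 : a < 1 := by simpa [a] using hy0
  have hay : y < machPotential a := by
    have h : machPotential a = Real.exp y - y := by
      simp [machPotential, a, Real.exp_neg]; ring
    have := Real.quadratic_le_exp_of_nonneg hy0.le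
    rw [h]; nlinarith
  obtain ⟨t, ht, hty⟩ := intermediate_value_Ioo' ha1.le
    (continuousOn_machPotential.mono fun t ht => ha0.trans_le ht.1)
    (show y ∈ Ioo (machPotential 1) (machPotential a) from ⟨by rwa [machPotential_one], hay⟩)
  exact ⟨t, ⟨ha0.trans ht.1, ht.2⟩, hty⟩

/-- The subsonic inverse of `machPotential`. -/
def subsonicMach (y : ℝ) : ℝ := if hy : 1 < y then (exists_machPotential_eq hy).choose else 0

theorem subsonicMach_mem {y : ℝ} (hy : 1 < y) : subsonicMach y ∈ Ioo (0 : ℝ) 1 := by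
  rw [subsonicMach, dif_pos hy]; exact (exists_machPotential_eq hy).choose_spec.1

theorem machPotential_subsonicMach {y : ℝ} (hy : 1 < y) : machPotential (subsonicMach y) = y := by
  rw [subsonicMach, dif_pos hy]; exact (exists_machPotential_eq hy).choose_spec.2

theorem subsonicMach_machPotential {t : ℝ} (ht : t ∈ Ioo 0 1) :
    subsonicMach (machPotential t) = t :=
  have h := one_lt_machPotential ht
  strictAntiOn_machPotential.injOn (Ioo_subset_Ioc_self (subsonicMach_mem h))
    (Ioo_subset_Ioc_self ht) (machPotential_subsonicMach h)

/-- The derivative of the potential vanishes only at `t = 1`, so there is an analytic local inverse.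
It stays in `(0, 1)` near `y`, and injectivity there identifies it with `subsonicMach`. -/
theorem analyticAt_subsonicMach {y : ℝ} (hy : 1 < y) : AnalyticAt ℝ subsonicMach y := by
  set t := subsonicMach y with ht_def
  have ht : t ∈ Ioo (0 : ℝ) 1 := subsonicMach_mem hy
  have hty : machPotential t = y := machPotential_subsonicMach hy
  have ha := analyticAt_machPotential ht.1
  have hd : deriv machPotential t ≠ 0 := by
    rw [(hasDerivAt_machPotential ht.1).deriv]
    exact div_ne_zero (by linarith [ht.2]) (pow_pos ht.1 2).ne'
  have hinv := ha.analyticAt_localInverse hd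
  set g := ha.hasStrictDerivAt.localInverse _ _ _ hd
  have hgt : g (machPotential t) = t := HasStrictFDerivAt.localInverse_apply_image ..
  rw [hty] at hinv hgt
  refine hinv.congr ?_
  have h1 : ∀ᶠ w in 𝓝 y, machPotential (g w) = w := by
    rw [← hty]; exact HasStrictDerivAt.eventually_right_inverse ..
  have h2 : ∀ᶠ w in 𝓝 y, g w ∈ Ioo (0 : ℝ) 1 :=
    hinv.continuousAt.eventually_mem (by rw [hgt]; exact isOpen_Ioo.mem_nhds ht)
  filter_upwards [h1, h2] with w hw1 hw2
  rw [← subsonicMach_machPotential hw2, hw1]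

/-! ### The jump of the potential across a shock. -/

/-- Squared Mach number behind a normal shock, as a function of the one in front of it. -/
def machBehind (γ τ : ℝ) : ℝ := (2 + (γ - 1) * τ) / (2 * γ * τ - (γ - 1))

theorem shock_denom_pos {γ τ : ℝ} (hγ : 1 < γ) (hτ : 1 < τ) : 0 < 2 * γ * τ - (γ - 1) := by
  nlinarith

theorem shock_num_pos {γ τ : ℝ} (hγ : 1 < γ) (hτ : 1 < τ) : 0 < 2 + (γ - 1) * τ := by
  nlinarith

theorem machBehind_mem {γ τ : ℝ} (hγ : 1 < γ) (hτ : 1 < τ) : machBehind γ τ ∈ Ioo (0 : ℝ) 1 := by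
  have h1 := shock_denom_pos hγ hτ
  refine ⟨div_pos (shock_num_pos hγ hτ) h1, (div_lt_one h1).2 ?_⟩
  nlinarith

theorem hasDerivAt_machBehind {γ τ : ℝ} (hγ : 1 < γ) (hτ : 1 < τ) :
    HasDerivAt (machBehind γ) (-(γ + 1) ^ 2 / (2 * γ * τ - (γ - 1)) ^ 2) τ := by
  have h1 := shock_denom_pos hγ hτ
  have hn : HasDerivAt (fun τ => 2 + (γ - 1) * τ) (γ - 1) τ := by
    simpa using ((hasDerivAt_id τ).const_mul (γ - 1)).const_add 2
  have hd : HasDerivAt (fun τ => 2 * γ * τ - (γ - 1)) (2 * γ) τ := by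
    simpa using ((hasDerivAt_id τ).const_mul (2 * γ)).sub_const (γ - 1)
  refine (hn.div hd h1.ne').congr_deriv ?_
  congr 1
  ring

theorem analyticAt_machBehind {γ τ : ℝ} (hγ : 1 < γ) (hτ : 1 < τ) :
    AnalyticAt ℝ (machBehind γ) τ :=
  AnalyticAt.div (by fun_prop) (by fun_prop) (shock_denom_pos hγ hτ).ne'

/-- Jump of `machPotential` across a normal shock. -/
def potentialJump (γ τ : ℝ) : ℝ := machPotential (machBehind γ τ) - machPotential τ

theorem analyticAt_potentialJump {γ τ : ℝ} (hγ : 1 < γ) (hτ : 1 < τ) :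
    AnalyticAt ℝ (potentialJump γ) τ :=
  ((analyticAt_machPotential (machBehind_mem hγ hτ).1).comp (analyticAt_machBehind hγ hτ)).sub
    (analyticAt_machPotential (one_pos.trans hτ))

/-- The quadratic polynomial that governs the sign of the derivative of `potentialJump`. -/
def jumpQuadratic (γ τ : ℝ) : ℝ :=
  2 * γ * (γ - 1) ^ 2 * τ ^ 2 + 4 * γ * (γ - 3) * τ + 4 * (γ - 1)

/-- Up to positive factors the derivative is `-jumpQuadratic`, so monotonicity reduces to the sign
of a quadratic. -/
theorem hasDerivAt_potentialJump {γ τ : ℝ} (hγ : 1 < γ) (hτ : 1 < τ) :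
    HasDerivAt (potentialJump γ) (-((τ - 1) ^ 2 * jumpQuadratic γ τ
      / (τ ^ 2 * (2 * γ * τ - (γ - 1)) * (2 + (γ - 1) * τ) ^ 2))) τ := by
  have h1 := shock_denom_pos hγ hτ
  have h2 := shock_num_pos hγ hτ
  have h0 : 0 < τ := one_pos.trans hτ
  have := ((hasDerivAt_machPotential (machBehind_mem hγ hτ).1).comp τ
    (hasDerivAt_machBehind hγ hτ)).sub (hasDerivAt_machPotential h0)
  refine this.congr_deriv ?_
  rw [machBehind, jumpQuadratic]
  field_simp
  ring

/-- On `(1, ∞)` the quadratic polynomial changes sign at most once, from negative to positive. -/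
theorem jumpQuadratic_nonneg_of_le {γ x y : ℝ} (hγ : 1 < γ) (hx : 1 < x) (hxy : x ≤ y)
    (h : 0 ≤ jumpQuadratic γ x) : 0 ≤ jumpQuadratic γ y := by
  have h1 : jumpQuadratic γ 1 = 2 * (γ - 2) * (γ + 1) ^ 2 := by rw [jumpQuadratic]; ring
  have ha : 0 < 2 * γ * (γ - 1) ^ 2 := by
    have : 0 < γ - 1 := by linarith
    positivity
  have hy : 1 < y := hx.trans_le hxy
  unfold jumpQuadratic at *
  rcases le_or_gt 2 γ with h2 | h2
  -- Expanded about 1, the quadratic has nonnegative coefficients if `γ ≥ 2`.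
  · have e : 2 * γ * (γ - 1) ^ 2 * y ^ 2 + 4 * γ * (γ - 3) * y + 4 * (γ - 1)
        = 2 * γ * (γ - 1) ^ 2 * (y - 1) ^ 2 + 4 * γ * (γ - 2) * (γ + 1) * (y - 1)
          + 2 * (γ - 2) * (γ + 1) ^ 2 := by ring
    have h3 : 0 ≤ γ - 2 := by linarith
    have h4 : 0 ≤ y - 1 := by linarith
    rw [e]; positivity
  · have hneg : 2 * (γ - 2) * (γ + 1) ^ 2 < 0 :=
      mul_neg_of_neg_of_pos (by linarith) (by positivity)
    by_contra! hlt
    have hxy' : x < y := lt_of_le_of_ne hxy (by rintro rfl; linarith)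
    -- convexity: `x` lies strictly between `1` and `y`
    have key : (y - 1) * (2 * γ * (γ - 1) ^ 2 * x ^ 2 + 4 * γ * (γ - 3) * x + 4 * (γ - 1))
        = (y - x) * (2 * γ * (γ - 1) ^ 2 * 1 ^ 2 + 4 * γ * (γ - 3) * 1 + 4 * (γ - 1))
          + (x - 1) * (2 * γ * (γ - 1) ^ 2 * y ^ 2 + 4 * γ * (γ - 3) * y + 4 * (γ - 1))
          - 2 * γ * (γ - 1) ^ 2 * ((y - x) * (x - 1) * (y - 1)) := by ring
    have k1 : 0 ≤ (y - 1) * (2 * γ * (γ - 1) ^ 2 * x ^ 2 + 4 * γ * (γ - 3) * x + 4 * (γ - 1)) :=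
      mul_nonneg (by linarith) h
    have k2 : (y - x) * (2 * γ * (γ - 1) ^ 2 * 1 ^ 2 + 4 * γ * (γ - 3) * 1 + 4 * (γ - 1)) < 0 :=
      mul_neg_of_pos_of_neg (by linarith) (by linarith)
    have k3 : (x - 1) * (2 * γ * (γ - 1) ^ 2 * y ^ 2 + 4 * γ * (γ - 3) * y + 4 * (γ - 1)) < 0 :=
      mul_neg_of_pos_of_neg (by linarith) hlt
    have k4 : 0 ≤ 2 * γ * (γ - 1) ^ 2 * ((y - x) * (x - 1) * (y - 1)) :=
      mul_nonneg ha.le (mul_nonneg (mul_nonneg (by linarith) (by linarith)) (by linarith))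
    linarith

/-- `potentialJump` is quasiconcave on `(1, ∞)`. -/
theorem ordConnected_potentialJump_gt {γ : ℝ} (hγ : 1 < γ) (a : ℝ) :
    OrdConnected {τ | 1 < τ ∧ a < potentialJump γ τ} := by
  refine ⟨fun x hx y hy w hw => ⟨hx.1.trans_le hw.1, ?_⟩⟩
  have hcont : ∀ u v : ℝ, 1 < u → ContinuousOn (potentialJump γ) (Icc u v) := fun u v hu t ht =>
    (hasDerivAt_potentialJump hγ (hu.trans_le ht.1)).continuousAt.continuousWithinAt
  have hpos : ∀ t : ℝ, 1 < t → 0 < t ^ 2 * (2 * γ * t - (γ - 1)) * (2 + (γ - 1) * t) ^ 2 :=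
    fun t ht => mul_pos (mul_pos (pow_pos (one_pos.trans ht) 2) (shock_denom_pos hγ ht))
      (pow_pos (shock_num_pos hγ ht) 2)
  have hw1 : 1 < w := hx.1.trans_le hw.1
  -- If the quadratic is nonnegative at `w`, it remains so up to `y` and the jump decreases on `[w,
  -- y]`. Otherwise it is nonpositive on `[x, w]` and the jump increases there. Either way the value
  -- at `w` is at least that at one end point.
  rcases le_or_gt 0 (jumpQuadratic γ w) with h | h
  · refine hy.2.trans_le (antitoneOn_of_deriv_nonpos (convex_Icc w y) (hcont w y hw1)
      (fun t ht => ?_) (fun t ht => ?_) (left_mem_Icc.2 hw.2) (right_mem_Icc.2 hw.2) hw.2)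
    all_goals rw [interior_Icc] at ht
    · exact (hasDerivAt_potentialJump hγ
        (hw1.trans ht.1)).differentiableAt.differentiableWithinAt
    · rw [(hasDerivAt_potentialJump hγ (hw1.trans ht.1)).deriv, neg_nonpos]
      exact div_nonneg (mul_nonneg (sq_nonneg _)
        (jumpQuadratic_nonneg_of_le hγ hw1 ht.1.le h)) (hpos t (hw1.trans ht.1)).le
  · refine hx.2.trans_le (monotoneOn_of_deriv_nonneg (convex_Icc x w) (hcont x w hx.1)
      (fun t ht => ?_) (fun t ht => ?_) (left_mem_Icc.2 hw.1) (right_mem_Icc.2 hw.1) hw.1)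
    all_goals rw [interior_Icc] at ht
    · exact (hasDerivAt_potentialJump hγ
        (hx.1.trans ht.1)).differentiableAt.differentiableWithinAt
    · rw [(hasDerivAt_potentialJump hγ (hx.1.trans ht.1)).deriv, neg_nonneg]
      have hq : jumpQuadratic γ t ≤ 0 := by
        by_contra! hq
        exact absurd (jumpQuadratic_nonneg_of_le hγ (hx.1.trans ht.1) ht.2.le hq.le) (by linarith)
      exact div_nonpos_of_nonpos_of_nonneg (mul_nonpos_of_nonneg_of_nonpos (sq_nonneg _) hq)
        (hpos t (hx.1.trans ht.1)).le

open FlowState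

namespace FlowState

variable {γ : ℝ} {s : FlowState}

theorem Physical.soundSq_pos (hs : s.Physical) (hγ : 0 < γ) : 0 < s.soundSq γ :=
  div_pos (mul_pos hγ hs.p_pos) hs.ρ_pos

theorem Physical.machSq_pos (hs : s.Physical) (hγ : 0 < γ) : 0 < s.machSq γ :=
  div_pos (pow_pos hs.u_pos 2) (hs.soundSq_pos hγ)

theorem Physical.machSq_mul_p (hs : s.Physical) (hγ : 0 < γ) :
    s.machSq γ * (γ * s.p) = s.ρ * s.u ^ 2 := by
  have := hs.p_pos.ne'
  have := hs.ρ_pos.ne'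
  rw [machSq, soundSq]; field_simp

theorem Physical.machSq_mul_soundSq (hs : s.Physical) (hγ : 0 < γ) :
    s.machSq γ * s.soundSq γ = s.u ^ 2 :=
  div_mul_cancel₀ _ (hs.soundSq_pos hγ).ne'

end FlowState

/-! ### The Mach number along a Fanno flow. -/

section Flow

variable {γ μ a b : ℝ} {V : ℝ → FlowState}

/-- Since `t = ρu²/(γp)`, the logarithmic derivative is `2u'/u + ρ'/ρ - p'/p = (2 - 1 + γ)
μt/(1-t)`. -/
theorem IsFannoFlow.hasDeriv_machSq (h : IsFannoFlow γ μ a b V) (hγ : 0 < γ) {x : ℝ}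
    (hx : x ∈ Icc a b) (ht : (V x).machSq γ ≠ 1) :
    HasDerivWithinAt (fun y => (V y).machSq γ)
      (μ * (γ + 1) * (V x).machSq γ ^ 2 / (1 - (V x).machSq γ)) (Icc a b) x := by
  have hp := (h.physical x hx).p_pos
  have hρ := (h.physical x hx).ρ_pos
  have hc := (h.physical x hx).soundSq_pos hγ
  have h1 : 1 - (V x).machSq γ ≠ 0 := sub_ne_zero.2 ht.symm
  have h2 : (V x).machSq γ - 1 ≠ 0 := sub_ne_zero.2 ht
  have hu := h.hasDeriv_u x hx
  have hp' := h.hasDeriv_p x hx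
  have hρ' := h.hasDeriv_ρ x hx
  have key := (hu.pow 2).div (((hp'.const_mul γ)).div hρ' hρ.ne') hc.ne'
  refine key.congr_deriv ?_
  have ht' : (V x).u ^ 2 = (V x).machSq γ * (γ * (V x).p / (V x).ρ) :=
    ((h.physical x hx).machSq_mul_soundSq hγ).symm
  generalize (V x).machSq γ = t at *
  have e1 : μ * γ * t / (t - 1) = -(μ * γ * t / (1 - t)) := by
    rw [← neg_sub 1 t, div_neg]
  have e2 : μ * t / (t - 1) = -(μ * t / (1 - t)) := by
    rw [← neg_sub 1 t, div_neg]
  rw [e1, e2]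
  simp only [Nat.cast_ofNat, Nat.add_one_sub_one, pow_one, Pi.pow_apply, Pi.div_apply]
  have e3 : (2 : ℝ) * (V x).u * (μ * t / (1 - t) * (V x).u)
      = 2 * (μ * t / (1 - t)) * (V x).u ^ 2 := by ring
  rw [e3, ht']
  field_simp
  ring

theorem IsFannoFlow.machPotential_eq (h : IsFannoFlow γ μ a b V) (hγ : 0 < γ)
    (ht : ∀ x ∈ Icc a b, (V x).machSq γ ≠ 1) {x : ℝ} (hx : x ∈ Icc a b) :
    machPotential ((V x).machSq γ) = machPotential ((V a).machSq γ) - μ * (γ + 1) * (x - a) := by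
  have hd : ∀ y ∈ Icc a b, HasDerivWithinAt
      (fun y => machPotential ((V y).machSq γ) + μ * (γ + 1) * y) 0 (Icc a b) y := by
    intro y hy
    have hpos := (h.physical y hy).machSq_pos hγ
    have h1 := (hasDerivAt_machPotential hpos).comp_hasDerivWithinAt y
      (h.hasDeriv_machSq hγ hy (ht y hy))
    have h2 := h1.add (((hasDerivAt_id y).const_mul (μ * (γ + 1))).hasDerivWithinAt)
    refine h2.congr_deriv ?_
    have : 1 - (V y).machSq γ ≠ 0 := sub_ne_zero.2 (ht y hy).symm
    field_simp
    ring
  have hle : a ≤ b := hx.1.trans hx.2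
  have := constant_of_derivWithin_zero (fun y hy => (hd y hy).differentiableWithinAt)
    (fun y hy => (hd y (Ico_subset_Icc_self hy)).derivWithin
      (uniqueDiffOn_Icc (hy.1.trans_lt hy.2) y (Ico_subset_Icc_self hy))) x hx
  linarith

/-- The Mach number of a supersonic Fanno flow is determined by its entry value. -/
theorem IsFannoFlow.machSq_eq_of_supersonic {V' : ℝ → FlowState} {b' : ℝ}
    (h : IsFannoFlow γ μ a b V) (h' : IsFannoFlow γ μ a b' V') (hγ : 0 < γ)
    (hV : ∀ x ∈ Icc a b, 1 < (V x).machSq γ) (hV' : ∀ x ∈ Icc a b', 1 < (V' x).machSq γ)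
    (heq : V a = V' a) {x : ℝ} (hx : x ∈ Icc a b) (hx' : x ∈ Icc a b') :
    (V x).machSq γ = (V' x).machSq γ := by
  refine strictMonoOn_machPotential.injOn (hV x hx).le (hV' x hx').le ?_
  rw [h.machPotential_eq hγ (fun y hy => (hV y hy).ne') hx,
    h'.machPotential_eq hγ (fun y hy => (hV' y hy).ne') hx', heq]

end Flow

/-! ### Rankine-Hugoniot relations in terms of the front Mach number. -/

section Shock

variable {γ : ℝ} {Sm Sp : FlowState}

/-- Eliminating pressure and density leaves a quadratic equation for the velocity behind the shock.
One root is the trivial `Sp.u = Sm.u`, which the entropy condition excludes; dividing it out leaves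
a linear equation. -/
theorem IsNormalShock.u_eq (h : IsNormalShock γ Sm Sp) (hγ : 1 < γ) :
    (γ + 1) * Sm.machSq γ * Sp.u = (2 + (γ - 1) * Sm.machSq γ) * Sm.u := by
  have hγ0 : 0 < γ := one_pos.trans hγ
  have hM := h.physical_minus.machSq_mul_p hγ0
  obtain ⟨hu, hp, hρ⟩ := h.physical_minus
  obtain ⟨hu', hp', hρ'⟩ := h.physical_plus
  have hmass := h.mass
  have hmom := h.momentum
  have hen := h.energy
  have hent := h.entropy
  rw [hmass] at hen
  have hen' := mul_left_cancel₀ (mul_pos hρ hu).ne' hen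
  set m := Sm.ρ * Sm.u with hm
  have hmpos : 0 < m := mul_pos hρ hu
  have r1 : Sp.p / Sp.ρ = Sp.p * Sp.u / m := by
    rw [div_eq_div_iff hρ'.ne' hmpos.ne', ← hmass]; ring
  have r2 : Sm.p / Sm.ρ = Sm.p * Sm.u / m := by
    rw [div_eq_div_iff hρ.ne' hmpos.ne', hm]; ring
  rw [FlowState.bernoulli, FlowState.bernoulli, r1, r2] at hen'
  have hγ1 : γ - 1 ≠ 0 := by linarith
  have hmom' : Sp.p - Sm.p = m * (Sm.u - Sp.u) := by
    have : Sp.ρ * Sp.u ^ 2 = m * Sp.u := by rw [← hmass]; ring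
    have : Sm.ρ * Sm.u ^ 2 = m * Sm.u := by rw [hm]; ring
    linarith
  have hΔ : Sm.u - Sp.u ≠ 0 := by
    intro h0; rw [h0, mul_zero] at hmom'; linarith
  have hE : (γ - 1) * m * (Sm.u ^ 2 - Sp.u ^ 2) = 2 * γ * (Sp.p * Sp.u - Sm.p * Sm.u) := by
    field_simp at hen'
    linarith
  have hprod : (Sm.u - Sp.u) * ((γ + 1) * (m * Sp.u))
      = (Sm.u - Sp.u) * ((γ - 1) * (m * Sm.u) + 2 * (γ * Sm.p)) := by
    have : Sp.p = Sm.p + m * (Sm.u - Sp.u) := by linarith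
    rw [this] at hE
    linear_combination (-1 : ℝ) * hE
  have hres := mul_left_cancel₀ hΔ hprod
  have hτ : Sm.machSq γ * (γ * Sm.p) = m * Sm.u := by rw [hM, hm]; ring
  have hgp : (γ * Sm.p) ≠ 0 := (mul_pos hγ0 hp).ne'
  refine mul_left_cancel₀ hmpos.ne' ?_
  linear_combination Sm.machSq γ * hres + 2 * hτ

theorem IsNormalShock.p_eq (h : IsNormalShock γ Sm Sp) (hγ : 1 < γ) :
    (γ + 1) * Sp.p = (2 * γ * Sm.machSq γ - (γ - 1)) * Sm.p := by
  have hγ0 : 0 < γ := one_pos.trans hγ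
  have hM := h.physical_minus.machSq_mul_p hγ0
  have hu := h.u_eq hγ
  have hτ := h.physical_minus.machSq_pos hγ0
  have h1 : Sp.p = Sm.p + Sm.ρ * Sm.u * (Sm.u - Sp.u) := by
    have e : Sp.ρ * Sp.u ^ 2 = Sm.ρ * Sm.u * Sp.u := by rw [← h.mass]; ring
    have := h.momentum
    rw [e] at this
    linarith
  refine mul_left_cancel₀ hτ.ne' ?_
  rw [h1]
  linear_combination (-Sm.ρ * Sm.u) * hu + (-(2 * Sm.machSq γ) + 2) * hM

theorem IsNormalShock.machSq_eq (h : IsNormalShock γ Sm Sp) (hγ : 1 < γ)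
    (hτ : 1 < Sm.machSq γ) : Sp.machSq γ = machBehind γ (Sm.machSq γ) := by
  have hγ0 : 0 < γ := one_pos.trans hγ
  have hM := h.physical_minus.machSq_mul_p hγ0
  have hM' := h.physical_plus.machSq_mul_p hγ0
  have hu := h.u_eq hγ
  have hp := h.p_eq hγ
  have hmass := h.mass
  have hden := shock_denom_pos hγ hτ
  rw [machBehind, eq_div_iff hden.ne']
  have hτ0 : 0 < Sm.machSq γ := one_pos.trans hτ
  have hpp := h.physical_minus.p_pos
  have hne : Sm.machSq γ * (γ * Sm.p) ≠ 0 := by positivity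
  refine mul_right_cancel₀ hne ?_
  have e : Sp.ρ * Sp.u ^ 2 = Sm.ρ * Sm.u * Sp.u := by rw [← hmass]; ring
  rw [e] at hM'
  linear_combination (-Sp.machSq γ * γ * Sm.machSq γ) * hp + Sm.machSq γ * (γ + 1) * hM'
    + Sm.ρ * Sm.u * hu - (2 + (γ - 1) * Sm.machSq γ) * hM

/-- Pressure in front of a normal shock divided by the pressure behind it. -/
def pressureRatio (γ τ : ℝ) : ℝ := (γ + 1) / (2 * γ * τ - (γ - 1))

/-- Square of the sonic speed in front of a normal shock divided by that behind it. -/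
def soundRatio (γ τ : ℝ) : ℝ := pressureRatio γ τ * ((γ + 1) * τ / (2 + (γ - 1) * τ))

theorem IsNormalShock.pressureRatio_mul (h : IsNormalShock γ Sm Sp) (hγ : 1 < γ)
    (hτ : 1 < Sm.machSq γ) : pressureRatio γ (Sm.machSq γ) * Sp.p = Sm.p := by
  have := shock_denom_pos hγ hτ
  rw [pressureRatio, div_mul_eq_mul_div, div_eq_iff this.ne', h.p_eq hγ]; ring

theorem IsNormalShock.soundRatio_mul (h : IsNormalShock γ Sm Sp) (hγ : 1 < γ)
    (hτ : 1 < Sm.machSq γ) : soundRatio γ (Sm.machSq γ) * Sp.soundSq γ = Sm.soundSq γ := by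
  have hn := shock_num_pos hγ hτ
  have hu := h.u_eq hγ
  have hr : (γ + 1) * Sm.machSq γ / (2 + (γ - 1) * Sm.machSq γ) = Sm.u / Sp.u := by
    rw [div_eq_div_iff hn.ne' h.physical_plus.u_pos.ne', hu]; ring
  rw [soundRatio, hr, soundSq, soundSq, ← h.pressureRatio_mul hγ hτ]
  have := h.physical_plus.u_pos
  have := h.physical_plus.ρ_pos
  have := h.physical_minus.ρ_pos
  rw [eq_div_iff (by positivity)]
  field_simp
  linear_combination (-pressureRatio γ (Sm.machSq γ) * Sp.p) * h.mass

/-- A normal shock exists behind every supersonic state. -/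
theorem exists_isNormalShock (hγ : 1 < γ) (hS : Sm.Physical) (hτ : 1 < Sm.machSq γ) :
    ∃ Sp, IsNormalShock γ Sm Sp := by
  have hγ0 : 0 < γ := one_pos.trans hγ
  have hγ1 : γ - 1 ≠ 0 := by linarith
  have hM := hS.machSq_mul_p hγ0
  have hd := shock_denom_pos hγ hτ
  have hn := shock_num_pos hγ hτ
  obtain ⟨hu, hp, hρ⟩ := hS
  generalize ht : Sm.machSq γ = τ at *
  have hτ0 : 0 < τ := one_pos.trans hτ
  have hn' : 0 < 2 + τ * (γ - 1) := by rwa [mul_comm τ]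
  have hρu : Sm.ρ = τ * (γ * Sm.p) / Sm.u ^ 2 := by rw [hM]; field_simp
  -- Velocity and pressure are forced by `u_eq` and `p_eq`, density by conservation of mass.
  refine ⟨⟨(2 + (γ - 1) * τ) / ((γ + 1) * τ) * Sm.u, (2 * γ * τ - (γ - 1)) / (γ + 1) * Sm.p,
    (γ + 1) * τ / (2 + (γ - 1) * τ) * Sm.ρ⟩, ⟨hu, hp, hρ⟩, ⟨?_, ?_, ?_⟩, ?_, ?_, ?_, ?_⟩
  · dsimp only; positivity
  · dsimp only; positivity
  · dsimp only; positivity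
  · dsimp only
    rw [hρu]; field_simp; ring
  · dsimp only; field_simp
  · have hm : (γ + 1) * τ / (2 + (γ - 1) * τ) * Sm.ρ * ((2 + (γ - 1) * τ) / ((γ + 1) * τ) * Sm.u)
        = Sm.ρ * Sm.u := by field_simp
    dsimp only [FlowState.bernoulli]
    rw [hm, hρu]
    field_simp
    ring
  · dsimp only
    rw [div_mul_eq_mul_div, lt_div_iff₀ (by linarith)]
    nlinarith [mul_pos hγ0 hp]

end Shock

/-! ### Reduction of the third order equation to a first order system. -/

section System

variable {γ μ L rb k κ : ℝ} {V : ℝ → FlowState} {W W₁ W₂ W₃ : ℝ → ℝ}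

/-- The pressure perturbation that belongs to a solution `W` of the third order equation. -/
def pressureAmp (μ : ℝ) (V : ℝ → FlowState) (W₁ : ℝ → ℝ) (y : ℝ) : ℝ := W₁ y / b μ V y

/-- Derivative of `pressureAmp`. -/
def pressureAmp' (μ rb L : ℝ) (V : ℝ → FlowState) (W₁ W₂ : ℝ → ℝ) (y : ℝ) : ℝ :=
  W₂ y / b μ V y - W₁ y * b' μ rb L V y / b μ V y ^ 2

/-- The integral in the inhomogeneity `e₅`. -/
def entropyIntegral (γ μ rb : ℝ) (V : ℝ → FlowState) (y : ℝ) : ℝ :=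
  ∫ τ in rb..y, 2 * μ / (γ - 1) * Real.exp (2 * μ * (τ - y)) * (V τ).ρ ^ (γ - 1)

/-- The terms that `d₃` multiplies in the third order equation. -/
def nonlocalTerm (γ μ rb κ : ℝ) (V : ℝ → FlowState) (W : ℝ → ℝ) (y : ℝ) : ℝ :=
  2 * μ ^ 3 * (Real.exp (-2 * μ * y) * (V y).ρ * W y)
    + μ ^ 2 * κ * ((V y).ρ * entropyIntegral γ μ rb V y)

/-- The term that `d₄` multiplies in the third order equation. -/
def entropyTerm (γ μ κ : ℝ) (V : ℝ → FlowState) (y : ℝ) : ℝ := μ ^ 2 * κ * (V y).ρ ^ γ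

theorem IsFannoFlow.b_pos (h : IsFannoFlow γ μ rb L V) {y : ℝ} (hy : y ∈ Icc rb L) :
    0 < b μ V y := div_pos (Real.exp_pos _) (h.physical y hy).ρ_pos

theorem hasDerivAt_exp_mul (c y : ℝ) :
    HasDerivAt (fun y => Real.exp (c * y)) (c * Real.exp (c * y)) y := by
  have := ((hasDerivAt_id y).const_mul c).exp
  exact this.congr_deriv (by simp [mul_comm])

theorem IsFannoFlow.hasDeriv_b (h : IsFannoFlow γ μ rb L V) {y : ℝ} (hy : y ∈ Icc rb L) :
    HasDerivWithinAt (b μ V)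
      (b μ V y * (2 * μ - μ * (V y).machSq γ / ((V y).machSq γ - 1))) (Icc rb L) y := by
  have hρ := (h.physical y hy).ρ_pos.ne'
  have := (hasDerivAt_exp_mul (2 * μ) y).hasDerivWithinAt.div (h.hasDeriv_ρ y hy) hρ
  refine this.congr_deriv ?_
  rw [b]
  field_simp

theorem IsFannoFlow.b'_eq (h : IsFannoFlow γ μ rb L V) (hL : rb < L) {y : ℝ}
    (hy : y ∈ Icc rb L) :
    b' μ rb L V y = b μ V y * (2 * μ - μ * (V y).machSq γ / ((V y).machSq γ - 1)) :=
  (h.hasDeriv_b hy).derivWithin (uniqueDiffOn_Icc hL y hy)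

theorem IsFannoFlow.hasDeriv_b' (h : IsFannoFlow γ μ rb L V) (hγ : 0 < γ) (hL : rb < L)
    (ht : ∀ x ∈ Icc rb L, (V x).machSq γ < 1) {y : ℝ} (hy : y ∈ Icc rb L) :
    HasDerivWithinAt (b' μ rb L V) (b'' μ rb L V y) (Icc rb L) y := by
  have hm := (h.hasDeriv_machSq hγ hy (ht y hy).ne).differentiableWithinAt
  have hb := (h.hasDeriv_b hy).differentiableWithinAt
  have hd : DifferentiableWithinAt ℝ
      (fun y => b μ V y * (2 * μ - μ * (V y).machSq γ / ((V y).machSq γ - 1))) (Icc rb L) y :=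
    hb.mul (((hm.const_mul μ).div (hm.sub_const 1)
      (sub_ne_zero.2 (ht y hy).ne)).const_sub (2 * μ))
  exact (hd.congr (fun x hx => h.b'_eq hL hx) (h.b'_eq hL hy)).hasDerivWithinAt

theorem IsFannoFlow.hasDeriv_ρ_rpow (h : IsFannoFlow γ μ rb L V) (c : ℝ) {y : ℝ}
    (hy : y ∈ Icc rb L) :
    HasDerivWithinAt (fun y => (V y).ρ ^ c)
      (c * (μ * (V y).machSq γ / ((V y).machSq γ - 1)) * (V y).ρ ^ c) (Icc rb L) y := by
  have hρ := (h.physical y hy).ρ_pos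
  have := (h.hasDeriv_ρ y hy).rpow_const (p := c) (Or.inl hρ.ne')
  refine this.congr_deriv ?_
  rw [Real.rpow_sub_one hρ.ne']
  field_simp

/-- The factor `exp (-2μy)` comes out of the integral, so the integral solves a linear equation in
which `y` no longer appears explicitly. -/
theorem IsFannoFlow.hasDeriv_entropyIntegral (h : IsFannoFlow γ μ rb L V) {y : ℝ}
    (hy : y ∈ Icc rb L) :
    HasDerivWithinAt (entropyIntegral γ μ rb V)
      (2 * μ / (γ - 1) * (V y).ρ ^ (γ - 1) - 2 * μ * entropyIntegral γ μ rb V y)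
      (Icc rb L) y := by
  let f : ℝ → ℝ := fun τ => 2 * μ / (γ - 1) * Real.exp (2 * μ * τ) * (V τ).ρ ^ (γ - 1)
  have hf : ContinuousOn f (Icc rb L) := by
    intro x hx
    exact ((hasDerivAt_exp_mul (2 * μ) x).continuousAt.continuousWithinAt.const_mul _).mul
      (h.hasDeriv_ρ_rpow (γ - 1) hx).continuousWithinAt
  have hE : entropyIntegral γ μ rb V = fun y => Real.exp (-2 * μ * y) * ∫ τ in rb..y, f τ := by
    ext y
    rw [entropyIntegral, ← intervalIntegral.integral_const_mul]
    refine intervalIntegral.integral_congr fun τ _ => ?_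
    have : Real.exp (2 * μ * (τ - y)) = Real.exp (-2 * μ * y) * Real.exp (2 * μ * τ) := by
      rw [← Real.exp_add]; congr 1; ring
    simp only [f, this]; ring
  have hint : IntervalIntegrable f volume rb y :=
    (hf.mono (by rw [uIcc_of_le hy.1]; exact Icc_subset_Icc_right hy.2)).intervalIntegrable
  have hI : HasDerivWithinAt (fun y => ∫ τ in rb..y, f τ) (f y) (Icc rb L) y := by
    have : Fact (y ∈ Icc rb L) := ⟨hy⟩
    exact intervalIntegral.integral_hasDerivWithinAt_right hint
      (hf.stronglyMeasurableAtFilter_nhdsWithin measurableSet_Icc y) (hf y hy)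
  rw [hE]
  refine ((hasDerivAt_exp_mul (-2 * μ) y).hasDerivWithinAt.mul hI).congr_deriv ?_
  have : Real.exp (-2 * μ * y) * Real.exp (2 * μ * y) = 1 := by
    rw [← Real.exp_add]; simp
  simp only [f]
  linear_combination (2 * μ / (γ - 1) * (V y).ρ ^ (γ - 1)) * this

theorem IsFannoFlow.hasDeriv_entropyTerm (h : IsFannoFlow γ μ rb L V) {y : ℝ}
    (hy : y ∈ Icc rb L) :
    HasDerivWithinAt (entropyTerm γ μ κ V)
      (γ * (μ * (V y).machSq γ / ((V y).machSq γ - 1)) * entropyTerm γ μ κ V y) (Icc rb L) y := by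
  refine ((h.hasDeriv_ρ_rpow γ hy).const_mul (μ ^ 2 * κ)).congr_deriv ?_
  rw [entropyTerm]; ring

/-- The weights `exp (-2μy) ρ` of `W` and `ρ` of the integral produce the same decay rate, so the
sum closes up as a single unknown. The sources simplify by `exp (-2μy) ρ = 1/b` and `ρ · ρ^(γ-1) =
ρ^γ`. -/
theorem IsFannoFlow.hasDeriv_nonlocalTerm (h : IsFannoFlow γ μ rb L V) {y : ℝ}
    (hW : HasDerivWithinAt W (W₁ y) (Icc rb L) y) (hy : y ∈ Icc rb L) :
    HasDerivWithinAt (nonlocalTerm γ μ rb κ V W)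
      (2 * μ ^ 3 * pressureAmp μ V W₁ y
        + (μ * (V y).machSq γ / ((V y).machSq γ - 1) - 2 * μ) * nonlocalTerm γ μ rb κ V W y
        + 2 * μ / (γ - 1) * entropyTerm γ μ κ V y) (Icc rb L) y := by
  have hρ := (h.physical y hy).ρ_pos
  have hρ' := h.hasDeriv_ρ y hy
  have hexp := (hasDerivAt_exp_mul (-2 * μ) y).hasDerivWithinAt (s := Icc rb L)
  have h1 := ((hexp.mul hρ').mul hW).const_mul (2 * μ ^ 3)
  have h2 := (hρ'.mul (h.hasDeriv_entropyIntegral hy)).const_mul (μ ^ 2 * κ)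
  refine (h1.add h2).congr_deriv ?_
  have hP : Real.exp (-2 * μ * y) * (V y).ρ * W₁ y = pressureAmp μ V W₁ y := by
    have : Real.exp (-2 * μ * y) * Real.exp (2 * μ * y) = 1 := by
      rw [← Real.exp_add]; simp
    rw [pressureAmp, b, eq_div_iff (by positivity)]
    calc Real.exp (-2 * μ * y) * (V y).ρ * W₁ y * (Real.exp (2 * μ * y) / (V y).ρ)
        = Real.exp (-2 * μ * y) * Real.exp (2 * μ * y) * W₁ y * ((V y).ρ / (V y).ρ) := by ring
      _ = W₁ y := by rw [this, div_self hρ.ne']; ring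
  have hγ : (V y).ρ ^ γ = (V y).ρ * (V y).ρ ^ (γ - 1) := by
    rw [Real.rpow_sub_one hρ.ne']; field_simp
  rw [← hP, nonlocalTerm, entropyTerm, hγ]
  simp only [Pi.mul_apply]
  ring

theorem hasDeriv_pressureAmp (h : IsFannoFlow γ μ rb L V) (hL : rb < L) {y : ℝ}
    (hW : HasDerivWithinAt W₁ (W₂ y) (Icc rb L) y) (hy : y ∈ Icc rb L) :
    HasDerivWithinAt (pressureAmp μ V W₁) (pressureAmp' μ rb L V W₁ W₂ y) (Icc rb L) y := by
  have hb := h.b_pos hy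
  have hb' := h.hasDeriv_b hy
  rw [← h.b'_eq hL hy] at hb'
  refine (hW.div hb' hb.ne').congr_deriv ?_
  rw [pressureAmp']
  field_simp

variable {Um : ℝ → FlowState}

/-- The coefficients `eTilde₁`, `eTilde₂`, `eTilde₃` are what the quotient rule yields from `e₁ P''
+ e₂ P' + (e₃ + k) P` with `P = W₁/b`; undoing this substitution removes `b` from the equation. -/
theorem hasDeriv_pressureAmp' (h : IsFannoFlow γ μ rb L V) (hγ : 0 < γ) (hL : rb < L)
    (ht : ∀ x ∈ Icc rb L, (V x).machSq γ < 1)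
    (hW : IsClassicalSolution γ μ L rb k Um V W W₁ W₂ W₃) {y : ℝ} (hy : y ∈ Icc rb L)
    (hκ : κ = μ₄ γ μ (Um rb) (V rb) / μ₂ γ μ (Um rb) (V rb)) :
    HasDerivWithinAt (pressureAmp' μ rb L V W₁ W₂)
      (-(1 / ((V y).machSq γ - 1)) *
        ((μ ^ 2 * d₂ γ ((V y).machSq γ) + k) * pressureAmp μ V W₁ y
          + μ * d₁ γ ((V y).machSq γ) * pressureAmp' μ rb L V W₁ W₂ y
          + d₃ γ ((V y).machSq γ) * nonlocalTerm γ μ rb κ V W y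
          + d₄ γ ((V y).machSq γ) * entropyTerm γ μ κ V y)) (Icc rb L) y := by
  have hb := h.b_pos hy
  have hb' := h.hasDeriv_b hy
  rw [← h.b'_eq hL hy] at hb'
  have hb'' := h.hasDeriv_b' hγ hL ht hy
  have hW2 := hW.deriv₂ y hy
  have hW3 := hW.deriv₃ y hy
  refine ((hW3.div hb' hb.ne').sub ((hW2.mul hb'').div (hb'.pow 2)
    (pow_ne_zero 2 hb.ne'))).congr_deriv ?_
  have heq := hW.equation y hy
  have h1 : (V y).machSq γ - 1 ≠ 0 := sub_ne_zero.2 (ht y hy).ne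
  have h54 : e₄ γ μ V y * W y + e₅ γ μ rb (Um rb) V y
      = d₃ γ ((V y).machSq γ) * nonlocalTerm γ μ rb κ V W y
        + d₄ γ ((V y).machSq γ) * entropyTerm γ μ κ V y := by
    rw [e₄, e₅, nonlocalTerm, entropyTerm, entropyIntegral, hκ]; ring
  rw [add_assoc, h54, eTilde₁, eTilde₂, eTilde₃, e₁, e₂, e₃] at heq
  rw [pressureAmp, pressureAmp']
  simp only [Pi.mul_apply, Pi.pow_apply, Nat.cast_ofNat, Nat.add_one_sub_one, pow_one]
  generalize nonlocalTerm γ μ rb κ V W y = N at *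
  generalize entropyTerm γ μ κ V y = S at *
  generalize d₁ γ ((V y).machSq γ) = D1 at *
  generalize d₂ γ ((V y).machSq γ) = D2 at *
  generalize d₃ γ ((V y).machSq γ) = D3 at *
  generalize d₄ γ ((V y).machSq γ) = D4 at *
  generalize (V y).machSq γ - 1 = t1 at *
  generalize b μ V y = B at *
  generalize b' μ rb L V y = B' at *
  generalize b'' μ rb L V y = B'' at *
  have key : t1 * (W₃ y / B - 2 * (W₂ y * B' / B ^ 2) - W₁ y * B'' / B ^ 2
      + 2 * W₁ y * B' ^ 2 / B ^ 3)
      = -((μ ^ 2 * D2 + k) * (W₁ y / B) + μ * D1 * (W₂ y / B - W₁ y * B' / B ^ 2)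
        + D3 * N + D4 * S) := by
    linear_combination heq
  have e : -(1 / t1) * ((μ ^ 2 * D2 + k) * (W₁ y / B) + μ * D1 * (W₂ y / B - W₁ y * B' / B ^ 2)
        + D3 * N + D4 * S) = W₃ y / B - 2 * (W₂ y * B' / B ^ 2) - W₁ y * B'' / B ^ 2
      + 2 * W₁ y * B' ^ 2 / B ^ 3 := by
    rw [neg_mul, one_div, ← mul_neg, ← key, inv_mul_cancel_left₀ h1]
  rw [e]
  field_simp
  ring

end System

/-! ### The system in the complex Mach variable. -/

section Complex

/-- A square array of complex numbers as an operator. -/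
def arrayOp : (Fin 4 → Fin 4 → ℂ) →ₗ[ℂ] ((Fin 4 → ℂ) →L[ℂ] (Fin 4 → ℂ)) :=
  (LinearMap.toContinuousLinearMap.toLinearMap ∘ₗ Matrix.toLin'.toLinearMap) ∘ₗ
    (Matrix.ofLinearEquiv ℂ).toLinearMap

theorem arrayOp_apply (m : Fin 4 → Fin 4 → ℂ) (v : Fin 4 → ℂ) (i : Fin 4) :
    arrayOp m v i = m i 0 * v 0 + m i 1 * v 1 + m i 2 * v 2 + m i 3 * v 3 := by
  simp [arrayOp, Matrix.mulVec, dotProduct, Fin.sum_univ_four]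

/-- The first order system for pressure amplitude, its derivative, nonlocal term and entropy term,
with the axial variable as independent variable. -/
def systemArray (γ μ k : ℝ) (z : ℂ) : Fin 4 → Fin 4 → ℂ :=
  ![![0, 1, 0, 0],
    ![-(1 / (z - 1)) * (μ ^ 2 * (1 / (z - 1) ^ 3 * (γ * (1 + γ) * z ^ 4 - 2 * γ * (1 + γ) * z ^ 3
          - (γ - 3) * z ^ 2 - 2 * (4 + γ) * z + 8)) + k),
      -(1 / (z - 1)) * (μ * (-(1 / (z - 1)) * ((1 + 2 * γ) * z ^ 2 + z - 2))),
      -(1 / (z - 1)) * (1 / (z - 1) ^ 3 * (γ * z ^ 2 + 3 * z - 4)),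
      -(1 / (z - 1)) * (-(1 / (γ - 1)) * (1 / (z - 1) ^ 3) *
        (γ * (γ - 1) * z ^ 3 + (5 * γ - 3) * z ^ 2 - 2 * (γ - 4) * z - 8))],
    ![2 * μ ^ 3, 0, μ * z / (z - 1) - 2 * μ, 2 * μ / (γ - 1)],
    ![0, 0, 0, γ * (μ * z / (z - 1))]]

/-- The same system with the squared Mach number as independent variable. -/
def machSystem (γ μ k : ℝ) (z : ℂ) : (Fin 4 → ℂ) →L[ℂ] (Fin 4 → ℂ) :=
  ((1 - z) / (μ * (γ + 1) * z ^ 2)) • arrayOp (systemArray γ μ k z)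

/-- The singular points 0 and 1 of the system lie on the boundary of this disc, which contains the
whole subsonic range. -/
theorem ne_of_mem_ball_half {z : ℂ} (hz : z ∈ ball (1 / 2 : ℂ) (1 / 2)) : z ≠ 0 ∧ z - 1 ≠ 0 := by
  rw [mem_ball, dist_eq_norm] at hz
  refine ⟨?_, fun h => ?_⟩
  · rintro rfl; norm_num at hz
  · rw [sub_eq_zero] at h; subst h; norm_num at hz

theorem ofReal_mem_ball_half {t : ℝ} (ht : t ∈ Ioo (0 : ℝ) 1) :
    (t : ℂ) ∈ ball (1 / 2 : ℂ) (1 / 2) := by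
  rw [mem_ball, dist_eq_norm]
  have : (t : ℂ) - 1 / 2 = ((t - 1 / 2 : ℝ) : ℂ) := by push_cast; ring
  rw [this, Complex.norm_real, Real.norm_eq_abs, abs_lt]
  constructor <;> linarith [ht.1, ht.2]

theorem differentiableOn_machSystem {γ μ : ℝ} (hγ : 1 < γ) (hμ : 0 < μ) (k : ℝ) :
    DifferentiableOn ℂ (machSystem γ μ k) (ball (1 / 2) (1 / 2)) := by
  intro z hz
  obtain ⟨h0, h1⟩ := ne_of_mem_ball_half hz
  have hμ' : (μ : ℂ) ≠ 0 := by exact_mod_cast hμ.ne'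
  have hγ' : (γ : ℂ) + 1 ≠ 0 := by exact_mod_cast (by linarith : γ + 1 ≠ 0)
  have hden : (μ : ℂ) * (γ + 1) * z ^ 2 ≠ 0 := mul_ne_zero (mul_ne_zero hμ' hγ') (pow_ne_zero 2 h0)
  have h13 : (z - 1) ^ 3 ≠ 0 := pow_ne_zero 3 h1
  have harr : DifferentiableAt ℂ (systemArray γ μ k) z := by
    refine differentiableAt_pi.2 fun i => differentiableAt_pi.2 fun j => ?_
    fin_cases i <;> fin_cases j <;> simp only [systemArray, Fin.zero_eta, Fin.mk_one,
      Fin.reduceFinMk, Matrix.cons_val] <;> fun_prop (disch := assumption)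
  have hop : DifferentiableAt ℂ (fun z => arrayOp (systemArray γ μ k z)) z :=
    (LinearMap.toContinuousLinearMap arrayOp).differentiableAt.comp z harr
  have hfac : DifferentiableAt ℂ (fun z : ℂ => (1 - z) / (μ * (γ + 1) * z ^ 2)) z := by
    fun_prop (disch := assumption)
  exact (hfac.smul hop).differentiableWithinAt

/-- The inverse fundamental solution carries a solution of the system back to a constant. -/
theorem fundamental_inverse_apply_const {γ μ k a c : ℝ} (hγ : 1 < γ) (hμ : 0 < μ)
    {Θ : ℂ → (Fin 4 → ℂ) →L[ℂ] (Fin 4 → ℂ)}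
    (hΘ : ∀ z ∈ ball (1 / 2 : ℂ) (1 / 2), HasDerivAt Θ (-(Θ z * machSystem γ μ k z)) z)
    {t : ℝ → ℝ} (ht : ∀ y ∈ Icc a c, t y ∈ Ioo (0 : ℝ) 1)
    (ht' : ∀ y ∈ Icc a c, HasDerivWithinAt t (μ * (γ + 1) * t y ^ 2 / (1 - t y)) (Icc a c) y)
    {Y : ℝ → Fin 4 → ℂ}
    (hY : ∀ y ∈ Icc a c, HasDerivWithinAt Y (arrayOp (systemArray γ μ k (t y)) (Y y)) (Icc a c) y)
    {y : ℝ} (hy : y ∈ Icc a c) : Θ (t y) (Y y) = Θ (t a) (Y a) := by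
  have hd : ∀ y ∈ Icc a c, HasDerivWithinAt (fun y => Θ (t y) (Y y)) 0 (Icc a c) y := by
    intro y hy
    have h1 : HasDerivWithinAt (fun y => Θ (t y)) _ (Icc a c) y :=
      (hΘ _ (ofReal_mem_ball_half (ht y hy))).scomp_hasDerivWithinAt y (ht' y hy).ofReal_comp
    have h2 := ((isBoundedBilinearMap_apply (𝕜 := ℂ) (E := Fin 4 → ℂ)
      (F := Fin 4 → ℂ)).hasFDerivAt (Θ (t y), Y y)).restrictScalars ℝ
    have h3 := h2.comp_hasDerivWithinAt (f := fun y => (Θ (t y), Y y)) y (h1.prodMk (hY y hy))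
    refine h3.congr_deriv ?_
    have hz0 : (t y : ℂ) ≠ 0 := by exact_mod_cast (ht y hy).1.ne'
    have hz1 : (1 : ℂ) - t y ≠ 0 := by exact_mod_cast (by linarith [(ht y hy).2] : 1 - t y ≠ 0)
    have hμ' : (μ : ℂ) ≠ 0 := by exact_mod_cast hμ.ne'
    have hγ' : (γ : ℂ) + 1 ≠ 0 := by exact_mod_cast (by linarith : γ + 1 ≠ 0)
    -- The speed `t'` cancels the factor introduced by the change of variable.
    have hone : ((μ : ℂ) * (γ + 1) * (t y) ^ 2 / (1 - t y)) * ((1 - t y) / (μ * (γ + 1) * (t y) ^ 2))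
        = 1 := by field_simp
    change Θ (t y) (arrayOp (systemArray γ μ k (t y)) (Y y))
      + (((μ * (γ + 1) * t y ^ 2 / (1 - t y) : ℝ) : ℂ) •
        -(Θ (t y) * machSystem γ μ k (t y))) (Y y) = 0
    push_cast
    simp only [machSystem]
    simp [smul_smul, hone]
  have hle : a ≤ c := hy.1.trans hy.2
  exact constant_of_derivWithin_zero (fun y hy => (hd y hy).differentiableWithinAt)
    (fun y hy => (hd y (Ico_subset_Icc_self hy)).derivWithin
      (uniqueDiffOn_Icc (hy.1.trans_lt hy.2) y (Ico_subset_Icc_self hy))) y hy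

/-- The unknowns of the first order system. -/
def stateVector (γ μ L rb κ : ℝ) (V : ℝ → FlowState) (W W₁ W₂ : ℝ → ℝ) (y : ℝ) : Fin 4 → ℂ :=
  ![(pressureAmp μ V W₁ y : ℂ), (pressureAmp' μ rb L V W₁ W₂ y : ℂ),
    (nonlocalTerm γ μ rb κ V W y : ℂ), (entropyTerm γ μ κ V y : ℂ)]

theorem hasDeriv_stateVector {γ μ L rb k κ : ℝ} {Um V : ℝ → FlowState} {W W₁ W₂ W₃ : ℝ → ℝ}
    (h : IsFannoFlow γ μ rb L V) (hγ : 0 < γ) (hL : rb < L)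
    (ht : ∀ x ∈ Icc rb L, (V x).machSq γ < 1)
    (hW : IsClassicalSolution γ μ L rb k Um V W W₁ W₂ W₃)
    (hκ : κ = μ₄ γ μ (Um rb) (V rb) / μ₂ γ μ (Um rb) (V rb)) {y : ℝ} (hy : y ∈ Icc rb L) :
    HasDerivWithinAt (stateVector γ μ L rb κ V W W₁ W₂)
      (arrayOp (systemArray γ μ k ((V y).machSq γ)) (stateVector γ μ L rb κ V W W₁ W₂ y))
      (Icc rb L) y := by
  refine hasDerivWithinAt_pi.2 fun i => ?_
  rw [arrayOp_apply]
  fin_cases i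
  · refine (hasDeriv_pressureAmp h hL (hW.deriv₂ y hy) hy).ofReal_comp.congr_deriv ?_
    simp [stateVector, systemArray]
  · refine (hasDeriv_pressureAmp' h hγ hL ht hW hy hκ).ofReal_comp.congr_deriv ?_
    simp [stateVector, systemArray, d₁, d₂, d₃, d₄]
    ring
  · refine (h.hasDeriv_nonlocalTerm (hW.deriv₁ y hy) hy).ofReal_comp.congr_deriv ?_
    simp [stateVector, systemArray]
  · refine (h.hasDeriv_entropyTerm hy).ofReal_comp.congr_deriv ?_
    simp [stateVector, systemArray]

end Complex

/-! ### Initial data behind the shock as functions of the front Mach number. -/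

section Initial

/-- `μ₂`, divided by `ρ c²` behind the shock, as a function of the squared Mach number in front. -/
def normμ₂ (γ μ τ : ℝ) : ℝ :=
  -2 * μ * (1 / (γ + 1) * ((γ - 1) * machBehind γ τ + 1)
    + machBehind γ τ / (1 - machBehind γ τ) * (soundRatio γ τ - 1))

/-- Initial value of the entropy term, multiplied by `normμ₂`. -/
def entropyInit (γ μ τ : ℝ) : ℝ :=
  2 * μ ^ 3 * ((γ - 1) / (γ + 1) * (1 - machBehind γ τ) + (soundRatio γ τ - 1))

/-- Initial slope of the pressure amplitude, multiplied by `normμ₂`. -/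
def slopeInit (γ μ k τ : ℝ) : ℝ :=
  μ * ((γ * machBehind γ τ ^ 2 - machBehind γ τ + 2) / (1 - machBehind γ τ) ^ 2) * normμ₂ γ μ τ
    + (machBehind γ τ + 2 / (γ - 1)) / (1 - machBehind γ τ) ^ 2 * (entropyInit γ μ τ / μ)
    + k * ((1 - pressureRatio γ τ) / (γ * (machBehind γ τ - 1)))

theorem analyticAt_pressureRatio {γ τ : ℝ} (hγ : 1 < γ) (hτ : 1 < τ) :
    AnalyticAt ℝ (pressureRatio γ) τ :=
  AnalyticAt.div (by fun_prop) (by fun_prop) (shock_denom_pos hγ hτ).ne'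

theorem analyticAt_soundRatio {γ τ : ℝ} (hγ : 1 < γ) (hτ : 1 < τ) :
    AnalyticAt ℝ (soundRatio γ) τ :=
  (analyticAt_pressureRatio hγ hτ).mul
    (AnalyticAt.div (by fun_prop) (by fun_prop) (shock_num_pos hγ hτ).ne')

theorem analyticAt_normμ₂ {γ τ : ℝ} (μ : ℝ) (hγ : 1 < γ) (hτ : 1 < τ) :
    AnalyticAt ℝ (normμ₂ γ μ) τ := by
  have hs := analyticAt_machBehind hγ hτ
  have hq := analyticAt_soundRatio hγ hτ
  have h1 : 1 - machBehind γ τ ≠ 0 := by linarith [(machBehind_mem hγ hτ).2]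
  unfold normμ₂
  fun_prop (disch := assumption)

theorem analyticAt_entropyInit {γ τ : ℝ} (μ : ℝ) (hγ : 1 < γ) (hτ : 1 < τ) :
    AnalyticAt ℝ (entropyInit γ μ) τ := by
  have hs := analyticAt_machBehind hγ hτ
  have hq := analyticAt_soundRatio hγ hτ
  unfold entropyInit
  fun_prop

theorem analyticAt_slopeInit {γ μ τ : ℝ} (k : ℝ) (hγ : 1 < γ) (hμ : 0 < μ) (hτ : 1 < τ) :
    AnalyticAt ℝ (slopeInit γ μ k) τ := by
  have hs := analyticAt_machBehind hγ hτ
  have hp := analyticAt_pressureRatio hγ hτ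
  have hm := analyticAt_normμ₂ μ hγ hτ
  have he := analyticAt_entropyInit μ hγ hτ
  have h1 : 1 - machBehind γ τ ≠ 0 := by linarith [(machBehind_mem hγ hτ).2]
  have h2 : (1 - machBehind γ τ) ^ 2 ≠ 0 := pow_ne_zero 2 h1
  have h3 : γ * (machBehind γ τ - 1) ≠ 0 :=
    mul_ne_zero (by linarith) (by linarith [(machBehind_mem hγ hτ).2])
  have h4 : μ ≠ 0 := hμ.ne'
  unfold slopeInit
  fun_prop (disch := assumption)

variable {γ μ : ℝ} {Sm Sp : FlowState}

/-- Every term in the braces of `μ₂` scales with `c²` behind the shock; what remains involves only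
ratios fixed by the front Mach number. -/
theorem IsNormalShock.μ₂_eq (h : IsNormalShock γ Sm Sp) (hγ : 1 < γ) (hτ : 1 < Sm.machSq γ) :
    μ₂ γ μ Sm Sp = Sp.ρ * Sp.soundSq γ * normμ₂ γ μ (Sm.machSq γ) := by
  have hγ0 : 0 < γ := one_pos.trans hγ
  have hc := h.physical_plus.soundSq_pos hγ0
  have hs := h.machSq_eq hγ hτ
  have hs1 : 1 - machBehind γ (Sm.machSq γ) ≠ 0 := by
    linarith [(machBehind_mem hγ hτ).2]
  have hu := h.physical_plus.machSq_mul_soundSq hγ0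
  rw [μ₂, normμ₂, ← h.soundRatio_mul hγ hτ, ← hu, hs]
  have e : Sp.soundSq γ - machBehind γ (Sm.machSq γ) * Sp.soundSq γ
      = (1 - machBehind γ (Sm.machSq γ)) * Sp.soundSq γ := by ring
  rw [e]
  generalize Sp.soundSq γ = c at *
  field_simp

theorem IsNormalShock.μ₄_mul_rpow (h : IsNormalShock γ Sm Sp) (hγ : 1 < γ)
    (hτ : 1 < Sm.machSq γ) :
    μ ^ 2 * (μ₄ γ μ Sm Sp * Sp.ρ ^ γ) = Sp.ρ * Sp.soundSq γ * entropyInit γ μ (Sm.machSq γ) := by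
  have hγ0 : 0 < γ := one_pos.trans hγ
  have hs := h.machSq_eq hγ hτ
  have hu := h.physical_plus.machSq_mul_soundSq hγ0
  have hρ : Sp.ρ ^ (1 - γ) * Sp.ρ ^ γ = Sp.ρ := by
    rw [← Real.rpow_add h.physical_plus.ρ_pos]; simp
  rw [μ₄, entropyInit, ← h.soundRatio_mul hγ hτ, ← hu, hs]
  linear_combination (2 * μ ^ 3 * ((γ - 1) / (γ + 1) * (Sp.soundSq γ
    - machBehind γ (Sm.machSq γ) * Sp.soundSq γ)
      + (soundRatio γ (Sm.machSq γ) * Sp.soundSq γ - Sp.soundSq γ))) * hρ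

theorem IsNormalShock.normμ₂_ne_zero (h : IsNormalShock γ Sm Sp) (hγ : 1 < γ)
    (hτ : 1 < Sm.machSq γ) : normμ₂ γ μ (Sm.machSq γ) ≠ 0 ↔ μ₂ γ μ Sm Sp ≠ 0 := by
  have h0 : Sp.ρ * Sp.soundSq γ ≠ 0 :=
    (mul_pos h.physical_plus.ρ_pos (h.physical_plus.soundSq_pos (one_pos.trans hγ))).ne'
  rw [h.μ₂_eq hγ hτ, mul_ne_zero_iff, and_iff_right h0]

theorem IsNormalShock.entropyInit_eq (h : IsNormalShock γ Sm Sp) (hγ : 1 < γ)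
    (hτ : 1 < Sm.machSq γ) (hμ₂ : μ₂ γ μ Sm Sp ≠ 0) :
    normμ₂ γ μ (Sm.machSq γ) * (μ ^ 2 * (μ₄ γ μ Sm Sp / μ₂ γ μ Sm Sp) * Sp.ρ ^ γ)
      = entropyInit γ μ (Sm.machSq γ) := by
  have h0 : Sp.ρ * Sp.soundSq γ ≠ 0 :=
    (mul_pos h.physical_plus.ρ_pos (h.physical_plus.soundSq_pos (one_pos.trans hγ))).ne'
  refine mul_left_cancel₀ h0 ?_
  rw [← h.μ₄_mul_rpow hγ hτ, ← mul_assoc, ← h.μ₂_eq hγ hτ]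
  field_simp

/-- The constants collapse: `μ₇/μ₈ = γ₁` and `1/μ₈ = (p⁺ - p⁻)/((t-1) μ₂)`. Multiplication by
`normμ₂` clears the denominator `μ₂`, so the result stays analytic across zeros of `normμ₂`. -/
theorem IsNormalShock.slopeInit_eq (h : IsNormalShock γ Sm Sp) (hγ : 1 < γ) (hμ : 0 < μ)
    (hτ : 1 < Sm.machSq γ) (hμ₂ : μ₂ γ μ Sm Sp ≠ 0) (k : ℝ) :
    normμ₂ γ μ (Sm.machSq γ) * (-((μ₇ γ μ Sm Sp - k) / μ₈ γ μ Sm Sp))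
      = slopeInit γ μ k (Sm.machSq γ) := by
  have hγ0 : 0 < γ := one_pos.trans hγ
  have hs := h.machSq_eq hγ hτ
  have hs' := machBehind_mem hγ hτ
  have hc := h.physical_plus.soundSq_pos hγ0
  have hρ := h.physical_plus.ρ_pos
  have hu := h.physical_plus.u_pos
  have hΔ : Sp.p - Sm.p ≠ 0 := by linarith [h.entropy]
  have hs1 : Sp.machSq γ - 1 ≠ 0 := by rw [hs]; linarith [hs'.2]
  have hm := (h.normμ₂_ne_zero hγ hτ).2 hμ₂
  have hZ : -((μ₇ γ μ Sm Sp - k) / μ₈ γ μ Sm Sp)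
      = -γ₁ γ μ Sm Sp + k * ((Sp.p - Sm.p) / (Sp.machSq γ - 1)) / μ₂ γ μ Sm Sp := by
    rw [μ₇, μ₈, μ₆, μ₅, γ₂, μ₀]
    generalize γ₁ γ μ Sm Sp = g
    generalize Sp.machSq γ = s at *
    field_simp
    ring
  have hp : (Sp.p - Sm.p) / (Sp.machSq γ - 1) = Sp.ρ * Sp.soundSq γ *
      ((1 - pressureRatio γ (Sm.machSq γ)) / (γ * (machBehind γ (Sm.machSq γ) - 1))) := by
    have hcp : Sp.ρ * Sp.soundSq γ = γ * Sp.p := by rw [soundSq]; field_simp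
    rw [hcp, ← hs, ← h.pressureRatio_mul hγ hτ]
    field_simp
  have hent := h.entropyInit_eq hγ hτ hμ₂
  rw [hZ, hp, γ₁, γ₀, slopeInit, ← hent, h.μ₂_eq hγ hτ, hs]
  have h0 : Sp.ρ * Sp.soundSq γ ≠ 0 := (mul_pos hρ hc).ne'
  generalize Sp.ρ * Sp.soundSq γ = R at *
  generalize normμ₂ γ μ (Sm.machSq γ) = m at *
  generalize (1 - pressureRatio γ (Sm.machSq γ)) / (γ * (machBehind γ (Sm.machSq γ) - 1)) = a at *
  generalize machBehind γ (Sm.machSq γ) = s at *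
  generalize Sp.ρ ^ γ = r at *
  generalize μ₄ γ μ Sm Sp = n at *
  have hμ0 := hμ.ne'
  field_simp
  ring

end Initial

/-! ### The exit amplitude as an analytic function of the front Mach number. -/

section ShockFunction

variable {γ μ k e : ℝ} {Ψ Θ : ℂ → (Fin 4 → ℂ) →L[ℂ] (Fin 4 → ℂ)}

/-- Initial values behind the shock, multiplied by `normμ₂`. -/
def initVector (γ μ k τ : ℝ) : Fin 4 → ℂ :=
  ![(normμ₂ γ μ τ : ℂ), (slopeInit γ μ k τ : ℂ), 0, (entropyInit γ μ τ : ℂ)]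

/-- Squared Mach number at the exit if that in front of the shock is `τ`; here `e` is the value
of `machPotential` at the exit of the shock-free supersonic flow. -/
def exitMach (γ e τ : ℝ) : ℝ := subsonicMach (potentialJump γ τ + e)

/-- Exit value of the pressure amplitude, multiplied by `normμ₂`, as a function of the squared
Mach number in front of the shock. -/
def exitAmp (Ψ Θ : ℂ → (Fin 4 → ℂ) →L[ℂ] (Fin 4 → ℂ)) (γ μ k e τ : ℝ) : ℂ :=
  Ψ (exitMach γ e τ) (Θ (machBehind γ τ) (initVector γ μ k τ)) 0

theorem analyticAt_initVector (hγ : 1 < γ) (hμ : 0 < μ) {τ : ℝ} (hτ : 1 < τ) :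
    AnalyticAt ℝ (initVector γ μ k) τ := by
  have hof : ∀ f : ℝ → ℝ, AnalyticAt ℝ f τ → AnalyticAt ℝ (fun x => (f x : ℂ)) τ := fun f hf =>
    (Complex.ofRealCLM.analyticAt _).comp hf
  refine analyticAt_pi_iff.2 fun i => ?_
  fin_cases i
  · exact hof _ (analyticAt_normμ₂ μ hγ hτ)
  · exact hof _ (analyticAt_slopeInit k hγ hμ hτ)
  · exact analyticAt_const
  · exact hof _ (analyticAt_entropyInit μ hγ hτ)

/-- The assumption `he` places the exit potential in the range of `machPotential` on `(0, 1)`, so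
`Ψ` and `Θ` are both evaluated inside their disc. -/
theorem analyticAt_exitAmp (hγ : 1 < γ) (hμ : 0 < μ)
    (hΨ : DifferentiableOn ℂ Ψ (ball (1 / 2) (1 / 2)))
    (hΘ : DifferentiableOn ℂ Θ (ball (1 / 2) (1 / 2))) {τ : ℝ} (hτ : 1 < τ)
    (he : 1 < potentialJump γ τ + e) : AnalyticAt ℝ (exitAmp Ψ Θ γ μ k e) τ := by
  have hcomp : ∀ (X : ℂ → (Fin 4 → ℂ) →L[ℂ] (Fin 4 → ℂ)) (f : ℝ → ℝ),
      DifferentiableOn ℂ X (ball (1 / 2) (1 / 2)) → AnalyticAt ℝ f τ → f τ ∈ Ioo (0 : ℝ) 1 →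
      AnalyticAt ℝ (fun x => X (f x)) τ := by
    intro X f hX hf hm
    have h1 : AnalyticAt ℝ X (f τ : ℂ) :=
      (hX.analyticAt (isOpen_ball.mem_nhds (ofReal_mem_ball_half hm))).restrictScalars
    have h2 : AnalyticAt ℝ (fun x => (f x : ℂ)) τ := (Complex.ofRealCLM.analyticAt _).comp hf
    exact h1.comp_of_eq h2 rfl
  have hJ : AnalyticAt ℝ (fun τ => potentialJump γ τ + e) τ :=
    (analyticAt_potentialJump hγ hτ).add analyticAt_const
  have hT : AnalyticAt ℝ (exitMach γ e) τ := AnalyticAt.comp (analyticAt_subsonicMach he) hJ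
  have happ : ∀ p : ((Fin 4 → ℂ) →L[ℂ] (Fin 4 → ℂ)) × (Fin 4 → ℂ),
      AnalyticAt ℝ (fun p : ((Fin 4 → ℂ) →L[ℂ] (Fin 4 → ℂ)) × (Fin 4 → ℂ) => p.1 p.2) p := fun p =>
    ((ContinuousLinearMap.analyticAt_bilinear
      (ContinuousLinearMap.id ℂ ((Fin 4 → ℂ) →L[ℂ] (Fin 4 → ℂ))) p)).restrictScalars
  have h1 := (happ _).fun_comp ((hcomp Θ _ hΘ (analyticAt_machBehind hγ hτ)
    (machBehind_mem hγ hτ)).prod (analyticAt_initVector (k := k) hγ hμ hτ))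
  have h2 := (happ _).fun_comp ((hcomp Ψ _ hΨ hT (subsonicMach_mem he)).prod h1)
  exact ((ContinuousLinearMap.proj (R := ℝ) (φ := fun _ : Fin 4 => ℂ) 0).analyticAt _).fun_comp h2

/-- In finite dimension a left inverse is also a right inverse. -/
theorem apply_fundamental_inverse {X X' : (Fin 4 → ℂ) →L[ℂ] (Fin 4 → ℂ)} (h : X' * X = 1)
    (v : Fin 4 → ℂ) : X (X' v) = v := by
  have h1 : X'.toLinearMap * X.toLinearMap = 1 := congrArg ContinuousLinearMap.toLinearMap h
  exact LinearMap.congr_fun (mul_eq_one_comm.1 h1) v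

/-- Without a subsonic stretch `Ψ` and `Θ` cancel, leaving the first initial value. -/
theorem exitAmp_of_exitMach_eq (hγ : 1 < γ)
    (hinv : ∀ z ∈ ball (1 / 2 : ℂ) (1 / 2), Θ z * Ψ z = 1) {τ : ℝ} (hτ : 1 < τ)
    (he : exitMach γ e τ = machBehind γ τ) : exitAmp Ψ Θ γ μ k e τ = normμ₂ γ μ τ := by
  rw [exitAmp, he, apply_fundamental_inverse
    (hinv _ (ofReal_mem_ball_half (machBehind_mem hγ hτ)))]
  rfl

/-- If the boundary value problem is solvable, then `exitAmp` vanishes. -/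
theorem exitAmp_eq_zero (hγ : 1 < γ) (hμ : 0 < μ)
    (hΘ : ∀ z ∈ ball (1 / 2 : ℂ) (1 / 2), HasDerivAt Θ (-(Θ z * machSystem γ μ k z)) z)
    (hinv : ∀ z ∈ ball (1 / 2 : ℂ) (1 / 2), Θ z * Ψ z = 1) {L rb : ℝ}
    {Um V : ℝ → FlowState} {W W₁ W₂ W₃ : ℝ → ℝ} (hL : rb < L)
    (hV : IsFannoFlow γ μ rb L V) (hsub : ∀ x ∈ Icc rb L, (V x).machSq γ < 1)
    (hshock : IsNormalShock γ (Um rb) (V rb)) (hsup : 1 < (Um rb).machSq γ)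
    (hμ₂ : μ₂ γ μ (Um rb) (V rb) ≠ 0)
    (hW : IsClassicalSolution γ μ L rb k Um V W W₁ W₂ W₃)
    (he : exitMach γ e ((Um rb).machSq γ) = (V L).machSq γ) :
    exitAmp Ψ Θ γ μ k e ((Um rb).machSq γ) = 0 := by
  have hγ0 : 0 < γ := one_pos.trans hγ
  have hrb : rb ∈ Icc rb L := left_mem_Icc.2 hL.le
  have hLL : L ∈ Icc rb L := right_mem_Icc.2 hL.le
  have ht : ∀ x ∈ Icc rb L, (V x).machSq γ ∈ Ioo (0 : ℝ) 1 := fun x hx =>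
    ⟨(hV.physical x hx).machSq_pos hγ0, hsub x hx⟩
  have hconst := fundamental_inverse_apply_const hγ hμ hΘ ht
    (fun y hy => hV.hasDeriv_machSq hγ0 hy (hsub y hy).ne)
    (fun y hy => hasDeriv_stateVector hV hγ0 hL hsub hW rfl hy) hLL
  set κ := μ₄ γ μ (Um rb) (V rb) / μ₂ γ μ (Um rb) (V rb)
  have hb := (hV.b_pos hrb).ne'
  -- At the shock `P = 1` and the nonlocal term is zero; in `P'` the contribution of `b'` cancels.
  have hinit : initVector γ μ k ((Um rb).machSq γ)
      = (normμ₂ γ μ ((Um rb).machSq γ) : ℂ) • stateVector γ μ L rb κ V W W₁ W₂ rb := by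
    have h0 : pressureAmp μ V W₁ rb = 1 := by
      rw [pressureAmp, hW.initial₁, div_self hb]
    have h1 : pressureAmp' μ rb L V W₁ W₂ rb
        = -((μ₇ γ μ (Um rb) (V rb) - k) / μ₈ γ μ (Um rb) (V rb)) := by
      rw [pressureAmp', hW.initial₁, hW.initial₂]
      generalize (μ₇ γ μ (Um rb) (V rb) - k) / μ₈ γ μ (Um rb) (V rb) = q
      field_simp
      ring
    have h2 : nonlocalTerm γ μ rb κ V W rb = 0 := by
      rw [nonlocalTerm, hW.initial₀, entropyIntegral, intervalIntegral.integral_same]; simp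
    have h3 := hshock.entropyInit_eq hγ hsup hμ₂
    have h4 := hshock.slopeInit_eq hγ hμ hsup hμ₂ k
    rw [initVector, stateVector, h0, h1, h2, entropyTerm, ← h3, ← h4]
    simp [κ]
  rw [exitAmp, hinit, map_smul, map_smul, ← hshock.machSq_eq hγ hsup, ← hconst, he,
    apply_fundamental_inverse (hinv _ (ofReal_mem_ball_half (ht L hLL)))]
  simp [stateVector, pressureAmp, hW.exit]

end ShockFunction

end Fanno
end

/-! ### The countable exceptional set. -/

theorem lemma4p1 (γ μ L : ℝ) (hγ : 1 < γ) (hμ : 0 < μ) (hL : 0 < L)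
    (U₀ : Fanno.FlowState) (V : ℝ → Fanno.FlowState)
    (hV₀ : V 0 = U₀)
    (hV : Fanno.IsFannoFlow γ μ 0 L V)
    (hsup : ∀ x ∈ Set.Icc 0 L, 1 < (V x).machSq γ)
    (hexit : ∀ Sp : Fanno.FlowState,
      Fanno.IsNormalShock γ (V L) Sp → Fanno.μ₂ γ μ (V L) Sp ≠ 0) :
    ∃ S : Set ℝ, S ⊆ Set.Ioo 0 L ∧ S.Countable ∧
      ∀ rb ∈ Set.Ioo 0 L \ S, ∀ Um Up : ℝ → Fanno.FlowState,
        Fanno.IsBackgroundSolution γ μ L U₀ rb Um Up →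
        (∀ y ∈ Set.Ioo rb L, (Up y).machSq γ < Fanno.t₀ γ) →
        Fanno.SCondition γ μ L rb Um Up := by
  open Fanno in
  have hγ0 : 0 < γ := one_pos.trans hγ
  have hLL : L ∈ Icc 0 L := right_mem_Icc.2 hL.le
  set τ : ℝ → ℝ := fun x => (V x).machSq γ with hτdef
  have hτL : 1 < τ L := hsup L hLL
  set e : ℝ := machPotential (τ L)
  have hpot : ∀ x ∈ Icc 0 L, machPotential (τ x) = e + μ * (γ + 1) * (L - x) := by
    intro x hx
    have h1 := hV.machPotential_eq hγ0 (fun y hy => (hsup y hy).ne') hx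
    have h2 := hV.machPotential_eq hγ0 (fun y hy => (hsup y hy).ne') hLL
    linarith
  have hinj : InjOn τ (Icc 0 L) := by
    intro x hx y hy hxy
    have h := (hpot x hx).symm.trans ((congrArg machPotential hxy).trans (hpot y hy))
    have hpos : μ * (γ + 1) ≠ 0 := (mul_pos hμ (by linarith)).ne'
    have := mul_left_cancel₀ hpos (add_left_cancel h)
    linarith
  choose Ψ Θ hΨ hΘ hinv using fun k : ℝ =>
    exists_fundamental_pair (differentiableOn_machSystem hγ hμ k)
  -- Front Mach numbers for which the flow behind the shock reaches the exit while still subsonic.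
  set K : Set ℝ := {t | 1 < t ∧ 1 - e < potentialJump γ t}
  have hK : IsPreconnected K := (ordConnected_potentialJump_gt hγ (1 - e)).isPreconnected
  have hjumpL : potentialJump γ (τ L) + e = machPotential (machBehind γ (τ L)) :=
    sub_add_cancel _ _
  have hτLK : τ L ∈ K := by
    have := one_lt_machPotential (machBehind_mem hγ hτL)
    exact ⟨hτL, by linarith⟩
  have hnorm : normμ₂ γ μ (τ L) ≠ 0 := by
    -- `hexit` speaks of given shocks at the exit; the existence of one turns it into a statement
    -- about `normμ₂`.
    obtain ⟨Sp, hSp⟩ := exists_isNormalShock hγ (hV.physical L hLL) hτL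
    exact (hSp.normμ₂_ne_zero hγ hτL).2 (hexit Sp hSp)
  have hcount : ∀ k : ℝ, {t ∈ K | exitAmp (Ψ k) (Θ k) γ μ k e t = 0}.Countable := by
    intro k
    refine countable_zeros_of_preconnected (fun t ht => ?_) hK hτLK ?_
    · exact analyticAt_exitAmp hγ hμ
        (fun z hz => (hΨ k z hz).differentiableAt.differentiableWithinAt)
        (fun z hz => (hΘ k z hz).differentiableAt.differentiableWithinAt) ht.1
        (by linarith [ht.2])
    · rw [exitAmp_of_exitMach_eq hγ (hinv k) hτL]
      · exact_mod_cast hnorm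
      · rw [exitMach, hjumpL, subsonicMach_machPotential (machBehind_mem hγ hτL)]
  have hcount₂ : {t ∈ K | normμ₂ γ μ t = 0}.Countable :=
    countable_zeros_of_preconnected (fun t ht => analyticAt_normμ₂ μ hγ ht.1) hK hτLK hnorm
  let Z : Set ℝ := {t ∈ K | normμ₂ γ μ t = 0} ∪ ⋃ m : ℤ × ℤ,
    {t ∈ K | exitAmp (Ψ ((m.1 : ℝ) ^ 2 + (m.2 : ℝ) ^ 2)) (Θ ((m.1 : ℝ) ^ 2 + (m.2 : ℝ) ^ 2))
      γ μ ((m.1 : ℝ) ^ 2 + (m.2 : ℝ) ^ 2) e t = 0}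
  have hZ : Z.Countable := hcount₂.union (countable_iUnion fun m => hcount _)
  refine ⟨{x ∈ Ioo 0 L | τ x ∈ Z}, fun x hx => hx.1, ?_, ?_⟩
  · exact MapsTo.countable_of_injOn (t := Z) (fun x hx => hx.2)
      (hinj.mono fun x hx => Ioo_subset_Icc_self hx.1) hZ
  rintro rb ⟨hrb, hrbS⟩ Um Up hbg -
  have hrbZ : τ rb ∉ Z := fun h => hrbS ⟨hrb, h⟩
  have hrb' : rb ∈ Icc 0 L := Ioo_subset_Icc_self hrb
  have hrr : rb ∈ Icc 0 rb := right_mem_Icc.2 hrb.1.le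
  have hUm : (Um rb).machSq γ = τ rb :=
    hbg.flow_minus.machSq_eq_of_supersonic hV hγ0 hbg.supersonic hsup
      (hbg.entry.trans hV₀.symm) hrr hrb'
  have hsup' := hbg.supersonic rb hrr
  have hLr : L ∈ Icc rb L := right_mem_Icc.2 hrb.2.le
  have htL : (Up L).machSq γ ∈ Ioo (0 : ℝ) 1 :=
    ⟨(hbg.flow_plus.physical L hLr).machSq_pos hγ0, hbg.subsonic L hLr⟩
  -- From `rb` to `L` both branches lose the same potential, so the jump at the shock persists
  -- unchanged to the exit.
  have hjump : potentialJump γ (τ rb) + e = machPotential ((Up L).machSq γ) := by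
    have h1 := hbg.flow_plus.machPotential_eq hγ0 (fun y hy => (hbg.subsonic y hy).ne) hLr
    rw [hbg.shock.machSq_eq hγ hsup', hUm] at h1
    rw [potentialJump, h1]
    linarith [hpot rb hrb']
  have hrbK : τ rb ∈ K := by
    have := one_lt_machPotential htL
    exact ⟨hUm ▸ hsup', by linarith⟩
  have hμ₂ : μ₂ γ μ (Um rb) (Up rb) ≠ 0 := by
    rw [← hbg.shock.normμ₂_ne_zero hγ hsup', hUm]
    exact fun h => hrbZ (Or.inl ⟨hrbK, h⟩)
  refine ⟨hμ₂, fun m ⟨W, W₁, W₂, W₃, hW⟩ => hrbZ (Or.inr (mem_iUnion.2 ⟨m, hrbK, ?_⟩))⟩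
  have hex : exitMach γ e ((Um rb).machSq γ) = (Up L).machSq γ := by
    rw [hUm, exitMach, hjump, subsonicMach_machPotential htL]
  rw [← hUm]
  exact exitAmp_eq_zero hγ hμ (hΘ _) (hinv _) hrb.2 hbg.flow_plus hbg.subsonic hbg.shock hsup'
    hμ₂ hW hex
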